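/- Let $k$ be a nonzero commutative unital ring and let $\mathrm{Mod}(k)$ be the monoidal category of $k$-modules with $\otimes=\otimes_k$. Let $\mathbf{fint}$ be the category of finite intervals: its objects are the posets $[n]=\{0,\dots,n\}$, $n\ge 0$, its morphisms are the order preserving maps that preserve the smallest and the largest element, and it is monoidal with $[m]\otimes[n]=[m+n]$ (glue the top of $[m]$ to the bottom of $[n]$) and unit $[0]$. For a set $S$, let $k\mathrm{Quiv}_S$ be the category of families $Q=(Q(a,b))_{a,b\in S}$ of $k$-modules, with monoidal product $(Q\otimes P)(a,b)=\bigoplus_{c\in S}Q(a,c)\otimes P(c,b)$ and unit $I_S$, where $I_S(a,b)=k$ if $a=b$ and $0$ otherwise. A *templicial module* is a pair $(X,S)$ of a set $S$ (the vertices) and a strongly unital, colax monoidal functor $X:\mathbf{fint}^{op}\to k\mathrm{Quiv}_S$; it has comultiplications $\mu_{m,n}:X_{m+n}(a,b)\to\bigoplus_{c\in S}X_m(a,c)\otimes X_n(c,b)$ and an invertible counit $X_0\to I_S$. A morphism $(X,S)\to(Y,T)$ is a map $f:S\to T$ with linear maps $X_n(a,b)\to Y_n(f(a),f(b))$ that are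 natural in $[n]$ and compatible with comultiplications and counits. This is the category $\mathrm{ts}\,\mathrm{Mod}(k)$. For a set $S$, let $\mathcal P_S$ be the 2-category with object set $S$, with 1-morphisms $a\to b$ the sequences $(a_0,\dots,a_n)$ in $S$, $n\ge0$, with $a_0=a$, $a_n=b$ (composed by concatenation along the common endpoint), and with 2-morphisms $(a_0,\dots,a_n)\to(b_0,\dots,b_m)$ the morphisms $h:[m]\to[n]$ of $\mathbf{fint}$ with $b_i=a_{h(i)}$ for all $i$. A *$\mathrm{Mod}(k)$-enriched precategory* (in the sense of Bacard) is a pair $(X,S)$ of a set $S$ and a strongly unital, colax functor of bicategories $X:\mathcal P_S\to\mathrm{Mod}(k)$, where $\mathrm{Mod}(k)$ is considered as a bicategory with one object. A morphism $(X,S)\to(Y,T)$ is a map $f:S\to T$ with linear maps $X(a_0,\dots,a_n)\to Y(f(a_0),\dots,f(a_n))$ that are natural and compatible with comultiplications and counits. This is the category $\mathbf{PC}(\mathrm{Mod}(k))$. The comparison functor $\mathfrak c':\mathbf{PC}(\mathrm{Mod}(k))\to\mathrm{ts}\,\mathrm{Mod}(k)$ keeps the set $S$ and is given by $$\mathfrak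 c'(X)_n(a,b)=\bigoplus_{(a_0,\dots,a_n),\ a_0=a,\ a_n=b}X(a_0,\dots,a_n),$$ with the structure maps induced by those of $X$. **Claim.** The functor $\mathfrak c'$ is not essentially surjective. Moreover, there is a templicial module $Y$ with the following properties. - Its vertex set has exactly the four distinct elements $a,c_1,c_2,b$. - There are edges $f_i\in Y_1(a,c_i)$, $g_i\in Y_1(c_i,b)$ ($i=1,2$) and $h\in Y_1(a,b)$, each of which is a basis of the module it lies in, and $Y_1(x,y)=0$ for all other pairs of vertices $x\neq y$. - There is a 2-simplex $w\in Y_2(a,b)$ with $$d_1(w)=h\qquad\text{and}\qquad\mu_{1,1}(w)=f_1\otimes g_1+f_2\otimes g_2,$$ where $d_1:Y_2\to Y_1$ is induced by $[1]\to[2]$, $0\mapsto 0$, $1\mapsto 2$. - The 2-simplex $w$ cannot be split over its inner vertices: there are no elements $w_x\in Y_2(a,b)$, for $x\in\{a,c_1,c_2,b\}$, with $w=w_a+w_{c_1}+w_{c_2}+w_b$ such that for every $x$, $\mu_{1,1}(w_x)$ lies in the summand $Y_1(a,x)\otimes Y_1(x,b)$. - $Y$ is not isomorphic to $\mathfrak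 c'(X)$ for any $\mathrm{Mod}(k)$-enriched precategory $X$. -/

import Mathlib

universe u

open CategoryTheory MonoidalCategory Opposite

noncomputable section

namespace Templicial

/-! ### Direct sums of modules, and their compatibility with tensor products -/

section DirectSums

variable {k : Type u} [CommRing k] {ι : Type u}

/-- The direct sum `⨁ i, M i` in `Mod(k)`. -/
def dsum (M : ι → ModuleCat.{u} k) : ModuleCat.{u} k :=
  ModuleCat.of k (DirectSum ι fun i => M i)

open Classical in
/-- The coprojection `M i ⟶ ⨁ i, M i`. -/
def inc (M : ι → ModuleCat.{u} k) (i : ι) : M i ⟶ dsum M :=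
  ModuleCat.ofHom (DirectSum.lof k ι (fun i => M i) i)

open Classical in
/-- The morphism out of `⨁ i, M i` with given components. -/
def desc {M : ι → ModuleCat.{u} k} {N : ModuleCat.{u} k} (f : ∀ i, M i ⟶ N) : dsum M ⟶ N :=
  ModuleCat.ofHom (DirectSum.toModule k ι N fun i => (f i).hom)

@[simp] theorem inc_desc {M : ι → ModuleCat.{u} k} {N : ModuleCat.{u} k} (f : ∀ i, M i ⟶ N) (i : ι) :
    inc M i ≫ desc f = f i := by
  classical
  ext x
  exact DirectSum.toModule_lof k (φ := fun i => (f i).hom) i x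

@[simp] theorem inc_desc_assoc {M : ι → ModuleCat.{u} k} {N : ModuleCat.{u} k} (f : ∀ i, M i ⟶ N) (i : ι) {Z : ModuleCat.{u} k} (z : _ ⟶ Z) :
    inc M i ≫ desc f ≫ z =
      f i ≫ z := by
  rw [reassoc_of% @inc_desc]

theorem dsum_ext {M : ι → ModuleCat.{u} k} {N : ModuleCat.{u} k} {f g : dsum M ⟶ N}
    (h : ∀ i, inc M i ≫ f = inc M i ≫ g) : f = g := by
  classical
  apply ModuleCat.hom_ext
  apply DirectSum.linearMap_ext
  intro i
  have := congrArg ModuleCat.Hom.hom (h i)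
  convert this using 1 <;> (simp only [inc]; congr!)

/-- The morphism out of `N ⊗ ⨁ i, M i` with given components. -/
def descR {M : ι → ModuleCat.{u} k} {N P : ModuleCat.{u} k} (f : ∀ i, N ⊗ M i ⟶ P) :
    N ⊗ dsum M ⟶ P :=
  MonoidalClosed.uncurry (desc fun i => MonoidalClosed.curry (f i))

@[simp] theorem inc_descR {M : ι → ModuleCat.{u} k} {N P : ModuleCat.{u} k} (f : ∀ i, N ⊗ M i ⟶ P)
    (i : ι) : N ◁ inc M i ≫ descR f = f i := by
  rw [descR, ← MonoidalClosed.uncurry_natural_left, inc_desc, MonoidalClosed.uncurry_curry]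

@[simp] theorem inc_descR_assoc {M : ι → ModuleCat.{u} k} {N P : ModuleCat.{u} k} (f : ∀ i, N ⊗ M i ⟶ P)
    (i : ι) {Z : ModuleCat.{u} k} (z : _ ⟶ Z) :
    N ◁ inc M i ≫ descR f ≫ z =
      f i ≫ z := by
  rw [reassoc_of% @inc_descR]

theorem dsumR_ext {M : ι → ModuleCat.{u} k} {N P : ModuleCat.{u} k} {f g : N ⊗ dsum M ⟶ P}
    (h : ∀ i, N ◁ inc M i ≫ f = N ◁ inc M i ≫ g) : f = g := by
  apply MonoidalClosed.curry_injective
  apply dsum_ext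
  intro i
  rw [← MonoidalClosed.curry_natural_left, ← MonoidalClosed.curry_natural_left, h]

/-- The morphism out of `(⨁ i, M i) ⊗ N` with given components. -/
def descL {M : ι → ModuleCat.{u} k} {N P : ModuleCat.{u} k} (f : ∀ i, M i ⊗ N ⟶ P) :
    dsum M ⊗ N ⟶ P :=
  (β_ (dsum M) N).hom ≫ descR fun i => (β_ (M i) N).inv ≫ f i

@[simp] theorem inc_descL {M : ι → ModuleCat.{u} k} {N P : ModuleCat.{u} k} (f : ∀ i, M i ⊗ N ⟶ P)
    (i : ι) : inc M i ▷ N ≫ descL f = f i := by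
  simp [descL]

@[simp] theorem inc_descL_assoc {M : ι → ModuleCat.{u} k} {N P : ModuleCat.{u} k} (f : ∀ i, M i ⊗ N ⟶ P)
    (i : ι) {Z : ModuleCat.{u} k} (z : _ ⟶ Z) :
    inc M i ▷ N ≫ descL f ≫ z =
      f i ≫ z := by
  rw [reassoc_of% @inc_descL]

theorem dsumL_ext {M : ι → ModuleCat.{u} k} {N P : ModuleCat.{u} k} {f g : dsum M ⊗ N ⟶ P}
    (h : ∀ i, inc M i ▷ N ≫ f = inc M i ▷ N ≫ g) : f = g := by
  rw [← cancel_epi (β_ (dsum M) N).inv]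
  apply dsumR_ext
  intro i
  simp [h]

end DirectSums

/-! ### The monoidal category of enriched quivers -/

section Quivers

variable (k : Type u) [CommRing k]

/-- A quiver enriched in `Mod(k)` with vertex set `S`: a family of modules `Q a b`. -/
structure Quiv (S : Type u) where
  /-- the module of edges from `a` to `b` -/
  obj : S → S → ModuleCat.{u} k

variable {k} {S : Type u}

instance : CoeFun (Quiv k S) fun _ => S → S → ModuleCat.{u} k := ⟨Quiv.obj⟩

namespace Quiv

/-- A morphism of quivers with vertex set `S`: a family of linear maps. -/
@[ext]
structure Hom (Q P : Quiv k S) where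
  /-- the component at the vertices `a`, `b` -/
  app : ∀ a b, Q a b ⟶ P a b

instance : Category (Quiv k S) where
  Hom Q P := Hom Q P
  id Q := ⟨fun a b => 𝟙 (Q a b)⟩
  comp f g := ⟨fun a b => f.app a b ≫ g.app a b⟩

@[simp] theorem id_app (Q : Quiv k S) (a b : S) : Hom.app (𝟙 Q) a b = 𝟙 (Q a b) := rfl

@[simp] theorem comp_app {Q P R : Quiv k S} (f : Q ⟶ P) (g : P ⟶ R) (a b : S) :
    (f ≫ g).app a b = f.app a b ≫ g.app a b := rfl

@[simp] theorem comp_app_assoc {Q P R : Quiv k S} (f : Q ⟶ P) (g : P ⟶ R) (a b : S) {Z : ModuleCat.{u} k} (z : _ ⟶ Z) :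
    (f ≫ g).app a b ≫ z =
      f.app a b ≫ g.app a b ≫ z := by
  rw [reassoc_of% @comp_app]

theorem hom_ext {Q P : Quiv k S} {f g : Q ⟶ P} (h : ∀ a b, f.app a b = g.app a b) : f = g :=
  Hom.ext (funext fun a => funext fun b => h a b)

/-- An isomorphism of quivers from isomorphisms in each component. -/
def isoMk {Q P : Quiv k S} (e : ∀ a b, Q a b ≅ P a b) : Q ≅ P where
  hom := ⟨fun a b => (e a b).hom⟩
  inv := ⟨fun a b => (e a b).inv⟩
  hom_inv_id := hom_ext fun a b => (e a b).hom_inv_id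
  inv_hom_id := hom_ext fun a b => (e a b).inv_hom_id

/-- `(Q ⊗ P)(a, b) = ⨁ c, Q(a, c) ⊗ P(c, b)`. -/
def tens (Q P : Quiv k S) : Quiv k S := ⟨fun a b => dsum fun c => Q a c ⊗ P c b⟩

/-- The coprojection `Q(a, c) ⊗ P(c, b) ⟶ (Q ⊗ P)(a, b)` -/
def tensInc (Q P : Quiv k S) (a c b : S) : Q a c ⊗ P c b ⟶ tens Q P a b :=
  inc (fun c => Q a c ⊗ P c b) c

/-- The unit quiver: `k` if `a = b` (the direct sum of one copy of `k`) and `0` otherwise (the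
empty direct sum). -/
def unit (k : Type u) [CommRing k] (S : Type u) : Quiv k S :=
  ⟨fun a b => dsum fun _ : ULift.{u} (PLift (a = b)) => 𝟙_ (ModuleCat.{u} k)⟩

/-- The coprojection `k ⟶ I_S(a, b)` for `a = b`. -/
def unitInc {a b : S} (h : a = b) : 𝟙_ (ModuleCat.{u} k) ⟶ unit k S a b :=
  inc (fun _ : ULift.{u} (PLift (a = b)) => 𝟙_ (ModuleCat.{u} k)) ⟨⟨h⟩⟩

section Universal

variable {Q P : Quiv k S} {a b : S} {N M : ModuleCat.{u} k}

/-- The morphism out of `(Q ⊗ P)(a, b)` with given components. -/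
def tensDesc (f : ∀ c, Q a c ⊗ P c b ⟶ M) : tens Q P a b ⟶ M := desc f

/-- The morphism out of `(Q ⊗ P)(a, b) ⊗ N` with given components. -/
def tensDescL (f : ∀ c, (Q a c ⊗ P c b) ⊗ N ⟶ M) : tens Q P a b ⊗ N ⟶ M := descL f

/-- The morphism out of `N ⊗ (Q ⊗ P)(a, b)` with given components. -/
def tensDescR (f : ∀ c, N ⊗ (Q a c ⊗ P c b) ⟶ M) : N ⊗ tens Q P a b ⟶ M := descR f

/-- The morphism out of `I_S(a, b)` with given components. -/
def unitDesc (f : a = b → (𝟙_ (ModuleCat.{u} k) ⟶ M)) : unit k S a b ⟶ M :=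
  desc fun h => f h.down.down

/-- The morphism out of `I_S(a, b) ⊗ N` with given components. -/
def unitDescL (f : a = b → (𝟙_ (ModuleCat.{u} k) ⊗ N ⟶ M)) : unit k S a b ⊗ N ⟶ M :=
  descL fun h => f h.down.down

/-- The morphism out of `N ⊗ I_S(a, b)` with given components. -/
def unitDescR (f : a = b → (N ⊗ 𝟙_ (ModuleCat.{u} k) ⟶ M)) : N ⊗ unit k S a b ⟶ M :=
  descR fun h => f h.down.down

theorem tens_ext {f g : tens Q P a b ⟶ M}
    (h : ∀ c, tensInc Q P a c b ≫ f = tensInc Q P a c b ≫ g) : f = g := dsum_ext h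

theorem tensL_ext {f g : tens Q P a b ⊗ N ⟶ M}
    (h : ∀ c, tensInc Q P a c b ▷ N ≫ f = tensInc Q P a c b ▷ N ≫ g) : f = g := dsumL_ext h

theorem tensR_ext {f g : N ⊗ tens Q P a b ⟶ M}
    (h : ∀ c, N ◁ tensInc Q P a c b ≫ f = N ◁ tensInc Q P a c b ≫ g) : f = g := dsumR_ext h

theorem unit_ext {f g : unit k S a b ⟶ M}
    (h : ∀ e : a = b, unitInc e ≫ f = unitInc e ≫ g) : f = g := dsum_ext fun e => h e.down.down

theorem unitL_ext {f g : unit k S a b ⊗ N ⟶ M}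
    (h : ∀ e : a = b, unitInc e ▷ N ≫ f = unitInc e ▷ N ≫ g) : f = g :=
  dsumL_ext fun e => h e.down.down

theorem unitR_ext {f g : N ⊗ unit k S a b ⟶ M}
    (h : ∀ e : a = b, N ◁ unitInc e ≫ f = N ◁ unitInc e ≫ g) : f = g :=
  dsumR_ext fun e => h e.down.down

theorem unitM_ext {L : ModuleCat.{u} k} {f g : (N ⊗ unit k S a b) ⊗ L ⟶ M}
    (h : ∀ e : a = b, (N ◁ unitInc e) ▷ L ≫ f = (N ◁ unitInc e) ▷ L ≫ g) : f = g := by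
  rw [← cancel_epi (β_ L (N ⊗ unit k S a b)).hom, ← cancel_epi (α_ L N (unit k S a b)).hom]
  apply unitR_ext
  intro e
  rw [associator_naturality_right_assoc, associator_naturality_right_assoc,
    BraidedCategory.braiding_naturality_right_assoc,
    BraidedCategory.braiding_naturality_right_assoc, h]

@[simp] theorem tensInc_desc (f : ∀ c, Q a c ⊗ P c b ⟶ M) (c : S) :
    tensInc Q P a c b ≫ tensDesc f = f c := inc_desc f c

@[simp] theorem tensInc_desc_assoc (f : ∀ c, Q a c ⊗ P c b ⟶ M) (c : S) {Z : ModuleCat.{u} k} (z : _ ⟶ Z) :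
    tensInc Q P a c b ≫ tensDesc f ≫ z =
      f c ≫ z := by
  rw [reassoc_of% @tensInc_desc]

@[simp] theorem tensInc_descL (f : ∀ c, (Q a c ⊗ P c b) ⊗ N ⟶ M) (c : S) :
    tensInc Q P a c b ▷ N ≫ tensDescL f = f c := inc_descL f c

@[simp] theorem tensInc_descL_assoc (f : ∀ c, (Q a c ⊗ P c b) ⊗ N ⟶ M) (c : S) {Z : ModuleCat.{u} k} (z : _ ⟶ Z) :
    tensInc Q P a c b ▷ N ≫ tensDescL f ≫ z =
      f c ≫ z := by
  rw [reassoc_of% @tensInc_descL]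

@[simp] theorem tensInc_descR (f : ∀ c, N ⊗ (Q a c ⊗ P c b) ⟶ M) (c : S) :
    N ◁ tensInc Q P a c b ≫ tensDescR f = f c := inc_descR f c

@[simp] theorem tensInc_descR_assoc (f : ∀ c, N ⊗ (Q a c ⊗ P c b) ⟶ M) (c : S) {Z : ModuleCat.{u} k} (z : _ ⟶ Z) :
    N ◁ tensInc Q P a c b ≫ tensDescR f ≫ z =
      f c ≫ z := by
  rw [reassoc_of% @tensInc_descR]

@[simp] theorem unitInc_desc (f : a = b → (𝟙_ (ModuleCat.{u} k) ⟶ M)) (e : a = b) :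
    unitInc e ≫ unitDesc f = f e := inc_desc _ _

@[simp] theorem unitInc_desc_assoc (f : a = b → (𝟙_ (ModuleCat.{u} k) ⟶ M)) (e : a = b) {Z : ModuleCat.{u} k} (z : _ ⟶ Z) :
    unitInc e ≫ unitDesc f ≫ z =
      f e ≫ z := by
  rw [reassoc_of% @unitInc_desc]

@[simp] theorem unitInc_descL (f : a = b → (𝟙_ (ModuleCat.{u} k) ⊗ N ⟶ M)) (e : a = b) :
    unitInc e ▷ N ≫ unitDescL f = f e := inc_descL _ _

@[simp] theorem unitInc_descL_assoc (f : a = b → (𝟙_ (ModuleCat.{u} k) ⊗ N ⟶ M)) (e : a = b) {Z : ModuleCat.{u} k} (z : _ ⟶ Z) :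
    unitInc e ▷ N ≫ unitDescL f ≫ z =
      f e ≫ z := by
  rw [reassoc_of% @unitInc_descL]

@[simp] theorem unitInc_descR (f : a = b → (N ⊗ 𝟙_ (ModuleCat.{u} k) ⟶ M)) (e : a = b) :
    N ◁ unitInc e ≫ unitDescR f = f e := inc_descR _ _

@[simp] theorem unitInc_descR_assoc (f : a = b → (N ⊗ 𝟙_ (ModuleCat.{u} k) ⟶ M)) (e : a = b) {Z : ModuleCat.{u} k} (z : _ ⟶ Z) :
    N ◁ unitInc e ≫ unitDescR f ≫ z =
      f e ≫ z := by
  rw [reassoc_of% @unitInc_descR]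

end Universal

/-- The morphism of quivers `f ⊗ g`. -/
def tensMap {Q Q' P P' : Quiv k S} (f : Q ⟶ Q') (g : P ⟶ P') : tens Q P ⟶ tens Q' P' :=
  ⟨fun a b => tensDesc fun c => (f.app a c ⊗ₘ g.app c b) ≫ tensInc Q' P' a c b⟩

@[simp] theorem tensInc_map {Q Q' P P' : Quiv k S} (f : Q ⟶ Q') (g : P ⟶ P') (a c b : S) :
    tensInc Q P a c b ≫ (tensMap f g).app a b = (f.app a c ⊗ₘ g.app c b) ≫ tensInc Q' P' a c b :=
  tensInc_desc _ c

@[simp] theorem tensInc_map_assoc {Q Q' P P' : Quiv k S} (f : Q ⟶ Q') (g : P ⟶ P') (a c b : S) {Z : ModuleCat.{u} k} (z : _ ⟶ Z) :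
    tensInc Q P a c b ≫ (tensMap f g).app a b ≫ z =
      (f.app a c ⊗ₘ g.app c b) ≫ tensInc Q' P' a c b ≫ z := by
  rw [reassoc_of% @tensInc_map]

/-- The associativity isomorphism `(Q ⊗ P) ⊗ R ≅ Q ⊗ (P ⊗ R)`. -/
def assoc (Q P R : Quiv k S) : tens (tens Q P) R ≅ tens Q (tens P R) :=
  isoMk fun a b =>
    { hom := tensDesc fun c => tensDescL fun d =>
        (α_ (Q a d) (P d c) (R c b)).hom ≫ Q a d ◁ tensInc P R d c b ≫
          tensInc Q (tens P R) a d b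
      inv := tensDesc fun d => tensDescR fun c =>
        (α_ (Q a d) (P d c) (R c b)).inv ≫ tensInc Q P a d c ▷ R c b ≫
          tensInc (tens Q P) R a c b
      hom_inv_id := tens_ext fun c => tensL_ext fun d => by simp
      inv_hom_id := tens_ext fun d => tensR_ext fun c => by simp }

/-- The left unit isomorphism `I_S ⊗ Q ≅ Q`. -/
def leftUnit (Q : Quiv k S) : tens (unit k S) Q ≅ Q :=
  isoMk fun a b =>
    { hom := tensDesc fun c => unitDescL fun h => (λ_ (Q c b)).hom ≫ eqToHom (by rw [h])
      inv := (λ_ (Q a b)).inv ≫ unitInc rfl ▷ Q a b ≫ tensInc (unit k S) Q a a b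
      hom_inv_id := tens_ext fun c => unitL_ext fun h => by
        obtain rfl := h
        simp
      inv_hom_id := by simp }

/-- The right unit isomorphism `Q ⊗ I_S ≅ Q`. -/
def rightUnit (Q : Quiv k S) : tens Q (unit k S) ≅ Q :=
  isoMk fun a b =>
    { hom := tensDesc fun c => unitDescR fun h => (ρ_ (Q a c)).hom ≫ eqToHom (by rw [h])
      inv := (ρ_ (Q a b)).inv ≫ Q a b ◁ unitInc rfl ≫ tensInc Q (unit k S) a b b
      hom_inv_id := tens_ext fun c => unitR_ext fun h => by
        obtain rfl := h
        simp
      inv_hom_id := by simp }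

section Lemmas

variable (Q P R : Quiv k S) (a b c d : S)

@[simp] theorem inc_assoc_hom :
    tensInc Q P a d c ▷ R c b ≫ tensInc (tens Q P) R a c b ≫ (assoc Q P R).hom.app a b =
      (α_ (Q a d) (P d c) (R c b)).hom ≫ Q a d ◁ tensInc P R d c b ≫
        tensInc Q (tens P R) a d b := by
  simp [assoc, isoMk]

@[simp] theorem inc_assoc_hom_assoc {Z : ModuleCat.{u} k} (z : _ ⟶ Z) :
    tensInc Q P a d c ▷ R c b ≫ tensInc (tens Q P) R a c b ≫ (assoc Q P R).hom.app a b ≫ z =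
      (α_ (Q a d) (P d c) (R c b)).hom ≫ Q a d ◁ tensInc P R d c b ≫
        tensInc Q (tens P R) a d b ≫ z := by
  rw [reassoc_of% @inc_assoc_hom]

@[simp] theorem inc_assoc_inv :
    Q a d ◁ tensInc P R d c b ≫ tensInc Q (tens P R) a d b ≫ (assoc Q P R).inv.app a b =
      (α_ (Q a d) (P d c) (R c b)).inv ≫ tensInc Q P a d c ▷ R c b ≫
        tensInc (tens Q P) R a c b := by
  simp [assoc, isoMk]

@[simp] theorem inc_assoc_inv_assoc {Z : ModuleCat.{u} k} (z : _ ⟶ Z) :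
    Q a d ◁ tensInc P R d c b ≫ tensInc Q (tens P R) a d b ≫ (assoc Q P R).inv.app a b ≫ z =
      (α_ (Q a d) (P d c) (R c b)).inv ≫ tensInc Q P a d c ▷ R c b ≫
        tensInc (tens Q P) R a c b ≫ z := by
  rw [reassoc_of% @inc_assoc_inv]

@[simp] theorem inc_leftUnit_hom :
    unitInc rfl ▷ Q a b ≫ tensInc (unit k S) Q a a b ≫ (leftUnit Q).hom.app a b =
      (λ_ (Q a b)).hom := by
  simp [leftUnit, isoMk]

@[simp] theorem inc_leftUnit_hom_assoc {Z : ModuleCat.{u} k} (z : _ ⟶ Z) :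
    unitInc rfl ▷ Q a b ≫ tensInc (unit k S) Q a a b ≫ (leftUnit Q).hom.app a b ≫ z =
      (λ_ (Q a b)).hom ≫ z := by
  rw [reassoc_of% @inc_leftUnit_hom]

@[simp] theorem inc_rightUnit_hom :
    Q a b ◁ unitInc rfl ≫ tensInc Q (unit k S) a b b ≫ (rightUnit Q).hom.app a b =
      (ρ_ (Q a b)).hom := by
  simp [rightUnit, isoMk]

@[simp] theorem inc_rightUnit_hom_assoc {Z : ModuleCat.{u} k} (z : _ ⟶ Z) :
    Q a b ◁ unitInc rfl ≫ tensInc Q (unit k S) a b b ≫ (rightUnit Q).hom.app a b ≫ z =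
      (ρ_ (Q a b)).hom ≫ z := by
  rw [reassoc_of% @inc_rightUnit_hom]

theorem leftUnit_inv_app : (leftUnit Q).inv.app a b =
    (λ_ (Q a b)).inv ≫ unitInc rfl ▷ Q a b ≫ tensInc (unit k S) Q a a b := rfl

theorem rightUnit_inv_app : (rightUnit Q).inv.app a b =
    (ρ_ (Q a b)).inv ≫ Q a b ◁ unitInc rfl ≫ tensInc Q (unit k S) a b b := rfl

end Lemmas

theorem tensMap_id (Q P : Quiv k S) : tensMap (𝟙 Q) (𝟙 P) = 𝟙 (tens Q P) :=
  hom_ext fun a b => tens_ext fun c => by simp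

theorem tensMap_comp {Q₁ Q₂ Q₃ P₁ P₂ P₃ : Quiv k S} (f₁ : Q₁ ⟶ Q₂) (g₁ : P₁ ⟶ P₂)
    (f₂ : Q₂ ⟶ Q₃) (g₂ : P₂ ⟶ P₃) :
    tensMap f₁ g₁ ≫ tensMap f₂ g₂ = tensMap (f₁ ≫ f₂) (g₁ ≫ g₂) :=
  hom_ext fun a b => tens_ext fun c => by simp

theorem assoc_naturality {Q₁ Q₂ Q₃ P₁ P₂ P₃ : Quiv k S} (f₁ : Q₁ ⟶ P₁) (f₂ : Q₂ ⟶ P₂)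
    (f₃ : Q₃ ⟶ P₃) :
    tensMap (tensMap f₁ f₂) f₃ ≫ (assoc P₁ P₂ P₃).hom =
      (assoc Q₁ Q₂ Q₃).hom ≫ tensMap f₁ (tensMap f₂ f₃) :=
  hom_ext fun a b => tens_ext fun c => tensL_ext fun d => by
    simp only [comp_app, tensInc_map_assoc, inc_assoc_hom_assoc, tensInc_map]
    rw [whiskerRight_comp_tensorHom_assoc, whiskerLeft_comp_tensorHom_assoc, tensInc_map,
      tensInc_map, ← tensorHom_comp_whiskerRight_assoc, ← tensorHom_comp_whiskerLeft_assoc,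
      inc_assoc_hom, associator_naturality_assoc]

theorem leftUnit_naturality {Q P : Quiv k S} (f : Q ⟶ P) :
    tensMap (𝟙 (unit k S)) f ≫ (leftUnit P).hom = (leftUnit Q).hom ≫ f :=
  hom_ext fun a b => tens_ext fun c => unitL_ext fun h => by
    obtain rfl := h
    simp [← whisker_exchange_assoc]

theorem rightUnit_naturality {Q P : Quiv k S} (f : Q ⟶ P) :
    tensMap f (𝟙 (unit k S)) ≫ (rightUnit P).hom = (rightUnit Q).hom ≫ f :=
  hom_ext fun a b => tens_ext fun c => unitR_ext fun h => by
    obtain rfl := h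
    simp [whisker_exchange_assoc]

theorem pentagon_aux (Q P R T : Quiv k S) :
    tensMap (assoc Q P R).hom (𝟙 T) ≫ (assoc Q (tens P R) T).hom ≫
        tensMap (𝟙 Q) (assoc P R T).hom =
      (assoc (tens Q P) R T).hom ≫ (assoc Q P (tens R T)).hom :=
  hom_ext fun a b => tens_ext fun c => tensL_ext fun d => by
    rw [← cancel_epi (α_ _ _ _).inv]
    apply tensL_ext
    intro e
    rw [← cancel_epi (α_ _ _ _).hom]
    simp only [comp_app, tensInc_map_assoc, id_app, tensorHom_id, inc_assoc_hom_assoc,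
      associator_inv_naturality_left_assoc, Iso.hom_inv_id_assoc]
    rw [← comp_whiskerRight_assoc, ← comp_whiskerRight_assoc, Category.assoc, inc_assoc_hom]
    simp only [comp_whiskerRight, Category.assoc, inc_assoc_hom_assoc, tensInc_map,
      associator_naturality_left_assoc, associator_naturality_middle_assoc, id_app, id_tensorHom]
    rw [← whisker_exchange_assoc, inc_assoc_hom, associator_naturality_right_assoc]
    simp only [← MonoidalCategory.whiskerLeft_comp_assoc, inc_assoc_hom]
    simp

theorem triangle_aux (Q P : Quiv k S) :
    (assoc Q (unit k S) P).hom ≫ tensMap (𝟙 Q) (leftUnit P).hom =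
      tensMap (rightUnit Q).hom (𝟙 P) :=
  hom_ext fun a b => tens_ext fun c => tensL_ext fun d => by
    refine unitM_ext fun h => ?_
    obtain rfl := h
    simp only [comp_app, tensInc_map, id_app, tensorHom_id, id_tensorHom,
      inc_assoc_hom_assoc]
    rw [← comp_whiskerRight_assoc, ← comp_whiskerRight_assoc, Category.assoc, inc_rightUnit_hom,
      associator_naturality_middle_assoc, ← MonoidalCategory.whiskerLeft_comp_assoc,
      ← MonoidalCategory.whiskerLeft_comp_assoc, Category.assoc, inc_leftUnit_hom,
      MonoidalCategory.triangle_assoc]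

instance : MonoidalCategory (Quiv k S) :=
  MonoidalCategory.mk (toMonoidalCategoryStruct :=
    { tensorObj := tens
      whiskerLeft := fun Q _ _ f => tensMap (𝟙 Q) f
      whiskerRight := fun f P => tensMap f (𝟙 P)
      tensorHom := fun f g => tensMap f g
      tensorUnit := unit k S
      associator := assoc
      leftUnitor := leftUnit
      rightUnitor := rightUnit })
    (tensorHom_def := fun f g => by simp [tensMap_comp])
    (id_tensorHom_id := tensMap_id)
    (tensorHom_comp_tensorHom := fun f₁ f₂ g₁ g₂ => tensMap_comp f₁ f₂ g₁ g₂)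
    (whiskerLeft_id := tensMap_id)
    (id_whiskerRight := tensMap_id)
    (associator_naturality := assoc_naturality)
    (leftUnitor_naturality := leftUnit_naturality)
    (rightUnitor_naturality := rightUnit_naturality)
    (pentagon := pentagon_aux)
    (triangle := triangle_aux)

/-! The monoidal structure in components -/

@[simp] theorem tensorObj_eq (Q P : Quiv k S) : Q ⊗ P = tens Q P := rfl
theorem tensorUnit_eq : 𝟙_ (Quiv k S) = unit k S := rfl

theorem whiskerLeft_eq (Q : Quiv k S) {P P' : Quiv k S} (f : P ⟶ P') :
    Q ◁ f = tensMap (𝟙 Q) f := rfl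
theorem whiskerRight_eq {Q Q' : Quiv k S} (f : Q ⟶ Q') (P : Quiv k S) :
    f ▷ P = tensMap f (𝟙 P) := rfl
theorem tensorHom_eq {Q Q' P P' : Quiv k S} (f : Q ⟶ Q') (g : P ⟶ P') :
    f ⊗ₘ g = tensMap f g := rfl
theorem associator_eq (Q P R : Quiv k S) : α_ Q P R = assoc Q P R := rfl
theorem leftUnitor_eq (Q : Quiv k S) : λ_ Q = leftUnit Q := rfl
theorem rightUnitor_eq (Q : Quiv k S) : ρ_ Q = rightUnit Q := rfl

end Quiv
end Quivers

/-! ### Finite intervals -/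

section FiniteIntervals

/-- The objects `[n] = {0, …, n}` of the category of finite intervals. -/
@[ext]
structure FinInt where
  /-- the last element of `[n]` -/
  len : ℕ

namespace FinInt

/-- A morphism `[m] ⟶ [n]` of finite intervals: an order preserving map which preserves the
endpoints. -/
@[ext]
structure Hom (m n : FinInt) where
  /-- the underlying map -/
  toFun : Fin (m.len + 1) → Fin (n.len + 1)
  monotone : Monotone toFun
  map_zero : toFun 0 = 0
  map_last : toFun (Fin.last m.len) = Fin.last n.len

instance : Category FinInt where
  Hom := Hom
  id n := ⟨id, monotone_id, rfl, rfl⟩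
  comp f g := ⟨g.toFun ∘ f.toFun, g.monotone.comp f.monotone,
    by simp [f.map_zero, g.map_zero], by simp [f.map_last, g.map_last]⟩

/-- The values of a morphism as natural numbers, extended by `m + j ↦ n + j` outside of `[m]`
(an auxiliary device for computing with sums of morphisms). -/
def Hom.nat {m n : FinInt} (f : m ⟶ n) (i : ℕ) : ℕ :=
  if h : i ≤ m.len then (f.toFun ⟨i, Nat.lt_succ_of_le h⟩).val else n.len + (i - m.len)

theorem Hom.nat_val {m n : FinInt} (f : m ⟶ n) (i : Fin (m.len + 1)) :
    (f.toFun i).val = f.nat i.val := by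
  have := i.2
  rw [Hom.nat, dif_pos (by omega)]

theorem hom_ext {m n : FinInt} {f g : m ⟶ n} (h : ∀ i, f.nat i = g.nat i) : f = g :=
  Hom.ext (funext fun i => Fin.ext (by rw [Hom.nat_val, Hom.nat_val, h]))

theorem Hom.nat_le {m n : FinInt} (f : m ⟶ n) {i : ℕ} (h : i ≤ m.len) : f.nat i ≤ n.len := by
  rw [Hom.nat, dif_pos h]
  omega

@[simp] theorem Hom.nat_zero {m n : FinInt} (f : m ⟶ n) : f.nat 0 = 0 := by
  rw [Hom.nat, dif_pos (Nat.zero_le _)]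
  exact congrArg Fin.val f.map_zero

@[simp] theorem Hom.nat_add {m n : FinInt} (f : m ⟶ n) (j : ℕ) :
    f.nat (m.len + j) = n.len + j := by
  by_cases h : j = 0
  · subst h
    rw [Hom.nat, dif_pos (by omega)]
    exact congrArg Fin.val f.map_last
  · rw [Hom.nat, dif_neg (by omega)]
    omega

@[simp] theorem Hom.nat_last {m n : FinInt} (f : m ⟶ n) : f.nat m.len = n.len :=
  f.nat_add 0

theorem nat_id (n : FinInt) (i : ℕ) : Hom.nat (𝟙 n) i = i := by
  by_cases h : i ≤ n.len
  · rw [Hom.nat, dif_pos h]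
    rfl
  · obtain ⟨j, rfl⟩ := Nat.exists_eq_add_of_le (Nat.le_of_not_le h)
    exact Hom.nat_add _ _

theorem nat_comp {l m n : FinInt} (f : l ⟶ m) (g : m ⟶ n) (i : ℕ) :
    Hom.nat (f ≫ g) i = g.nat (f.nat i) := by
  by_cases h : i ≤ l.len
  · rw [Hom.nat, dif_pos h]
    change (g.toFun (f.toFun _)).val = _
    rw [Hom.nat_val, Hom.nat_val]
  · obtain ⟨j, rfl⟩ := Nat.exists_eq_add_of_le (Nat.le_of_not_le h)
    rw [Hom.nat_add, Hom.nat_add, Hom.nat_add]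

/-- `[m] + [n] = [m + n]` -/
def sum (m n : FinInt) : FinInt := ⟨m.len + n.len⟩

@[simp] theorem sum_len (m n : FinInt) : (sum m n).len = m.len + n.len := rfl

/-- The sum of two morphisms: `f` on `{0, …, m}` and `g` on `{m, …, m + m'}`. -/
def sumMap {m n m' n' : FinInt} (f : m ⟶ n) (g : m' ⟶ n') : sum m m' ⟶ sum n n' where
  toFun i :=
    if h : i.val ≤ m.len then
      ⟨(f.toFun ⟨i.val, by omega⟩).val, by simp only [sum]; omega⟩
    else
      ⟨n.len + (g.toFun ⟨i.val - m.len, by have := i.2; simp only [sum] at this; omega⟩).val,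
        by simp only [sum]; omega⟩
  monotone i j hij := by
    have hij' : i.val ≤ j.val := hij
    dsimp only
    split_ifs with h₁ h₂
    · exact f.monotone (show (⟨i.val, _⟩ : Fin (m.len + 1)) ≤ ⟨j.val, _⟩ from hij')
    · rw [Fin.le_def]
      dsimp only
      omega
    · omega
    · rw [Fin.le_def]
      exact Nat.add_le_add_left (g.monotone (show (⟨i.val - m.len, _⟩ : Fin (m'.len + 1)) ≤
        ⟨j.val - m.len, _⟩ from Nat.sub_le_sub_right hij' _)) _
  map_zero := by
    rw [dif_pos (by simp)]
    exact Fin.ext (show (f.toFun 0).val = 0 by rw [f.map_zero]; rfl)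
  map_last := by
    apply Fin.ext
    split_ifs with h
    · have h0 : m'.len = 0 := by simpa [sum] using h
      have h1 := f.nat_last
      have h2 := g.nat_zero
      have h3 := g.nat_last
      rw [h0, h2] at h3
      simp only [sum, Fin.val_last, Hom.nat_val, h0, ← h3, Nat.add_zero, h1]
    · simp [sum, Hom.nat_val]

theorem nat_sumMap {m n m' n' : FinInt} (f : m ⟶ n) (g : m' ⟶ n') (i : ℕ) :
    (sumMap f g).nat i = if i ≤ m.len then f.nat i else n.len + g.nat (i - m.len) := by
  by_cases h : i ≤ (sum m m').len
  · rw [Hom.nat, dif_pos h]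
    simp only [sumMap]
    split_ifs with h'
    · simp [Hom.nat_val]
    · simp [Hom.nat_val]
  · obtain ⟨j, rfl⟩ := Nat.exists_eq_add_of_le (Nat.le_of_not_le h)
    rw [sum_len] at h ⊢
    rw [if_neg (by omega), show m.len + m'.len + j - m.len = m'.len + j by omega, Hom.nat_add,
      ← Nat.add_assoc]
    exact Hom.nat_add (sumMap f g) j

theorem nat_sumMap_left {m n m' n' : FinInt} (f : m ⟶ n) (g : m' ⟶ n') {i : ℕ}
    (h : i ≤ m.len) : (sumMap f g).nat i = f.nat i := by
  rw [nat_sumMap, if_pos h]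

theorem nat_sumMap_right {m n m' n' : FinInt} (f : m ⟶ n) (g : m' ⟶ n') (i : ℕ) :
    (sumMap f g).nat (m.len + i) = n.len + g.nat i := by
  rw [nat_sumMap]
  split_ifs with h'
  · obtain rfl : i = 0 := by omega
    simp
  · simp

/-- The morphism `i ↦ i` between intervals of equal length. -/
def castHom {m n : FinInt} (h : m.len = n.len) : m ⟶ n where
  toFun i := Fin.cast (by rw [h]) i
  monotone _ _ hij := hij
  map_zero := rfl
  map_last := Fin.ext h

theorem nat_castHom {m n : FinInt} (h : m.len = n.len) (i : ℕ) : (castHom h).nat i = i := by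
  rw [Hom.nat]
  split_ifs with hi
  · rfl
  · omega

/-- The isomorphism `i ↦ i` between intervals of equal length. -/
def castIso {m n : FinInt} (h : m.len = n.len) : m ≅ n where
  hom := castHom h
  inv := castHom h.symm
  hom_inv_id := hom_ext fun i => by simp only [nat_comp, nat_castHom, nat_id]
  inv_hom_id := hom_ext fun i => by simp only [nat_comp, nat_castHom, nat_id]

theorem sumMap_id (m n : FinInt) : sumMap (𝟙 m) (𝟙 n) = 𝟙 (sum m n) :=
  hom_ext fun i => by
    simp only [nat_sumMap, nat_id]
    split_ifs <;> omega

theorem sumMap_comp {m₁ m₂ m₃ n₁ n₂ n₃ : FinInt} (f₁ : m₁ ⟶ m₂) (g₁ : n₁ ⟶ n₂)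
    (f₂ : m₂ ⟶ m₃) (g₂ : n₂ ⟶ n₃) :
    sumMap f₁ g₁ ≫ sumMap f₂ g₂ = sumMap (f₁ ≫ f₂) (g₁ ≫ g₂) :=
  hom_ext fun i => by
    rw [nat_comp, nat_sumMap f₁, nat_sumMap (f₁ ≫ f₂)]
    split_ifs with h
    · rw [nat_sumMap_left _ _ (f₁.nat_le h), nat_comp]
    · rw [nat_sumMap_right, nat_comp]

theorem associator_naturality_aux {m₁ m₂ m₃ n₁ n₂ n₃ : FinInt} (f₁ : m₁ ⟶ n₁) (f₂ : m₂ ⟶ n₂)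
    (f₃ : m₃ ⟶ n₃) (h : (sum (sum m₁ m₂) m₃).len = (sum m₁ (sum m₂ m₃)).len)
    (h' : (sum (sum n₁ n₂) n₃).len = (sum n₁ (sum n₂ n₃)).len) :
    sumMap (sumMap f₁ f₂) f₃ ≫ castHom h' = castHom h ≫ sumMap f₁ (sumMap f₂ f₃) :=
  hom_ext fun i => by
    simp only [nat_comp, nat_castHom]
    simp only [nat_sumMap, sum_len, Nat.sub_sub]
    split_ifs <;> omega

/-- The unit `[0]`. -/
def zero : FinInt := ⟨0⟩

@[simp] theorem zero_len : zero.len = 0 := rfl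

theorem leftUnitor_naturality_aux {m n : FinInt} (f : m ⟶ n) (h : (sum zero m).len = m.len)
    (h' : (sum zero n).len = n.len) : sumMap (𝟙 zero) f ≫ castHom h' = castHom h ≫ f :=
  hom_ext fun i => by
    simp only [nat_comp, nat_castHom, nat_sumMap, nat_id, zero_len]
    split_ifs with h
    · obtain rfl : i = 0 := by omega
      simp
    · simp

theorem rightUnitor_naturality_aux {m n : FinInt} (f : m ⟶ n) (h : (sum m zero).len = m.len)
    (h' : (sum n zero).len = n.len) : sumMap f (𝟙 zero) ≫ castHom h' = castHom h ≫ f :=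
  hom_ext fun i => by
    simp only [nat_comp, nat_castHom, nat_sumMap, nat_id]
    split_ifs with h
    · rfl
    · obtain ⟨j, rfl⟩ := Nat.exists_eq_add_of_le (Nat.le_of_not_le h)
      simp

theorem pentagon_aux (m n l j : FinInt)
    (h₁ : (sum (sum m n) l).len = (sum m (sum n l)).len)
    (h₂ : (sum (sum m (sum n l)) j).len = (sum m (sum (sum n l) j)).len)
    (h₃ : (sum (sum n l) j).len = (sum n (sum l j)).len)
    (h₄ : (sum (sum (sum m n) l) j).len = (sum (sum m n) (sum l j)).len)
    (h₅ : (sum (sum m n) (sum l j)).len = (sum m (sum n (sum l j))).len) :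
    sumMap (castHom h₁) (𝟙 j) ≫ castHom h₂ ≫ sumMap (𝟙 m) (castHom h₃) =
      castHom h₄ ≫ castHom h₅ :=
  hom_ext fun i => by
    simp only [nat_comp, nat_castHom, nat_sumMap, nat_id, sum_len]
    split_ifs <;> omega

theorem triangle_aux (m n : FinInt)
    (h₁ : (sum (sum m zero) n).len = (sum m (sum zero n)).len) (h₂ : (sum zero n).len = n.len)
    (h₃ : (sum m zero).len = m.len) :
    castHom h₁ ≫ sumMap (𝟙 m) (castHom h₂) = sumMap (castHom h₃) (𝟙 n) :=
  hom_ext fun i => by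
    simp only [nat_comp, nat_castHom, nat_sumMap, nat_id, sum_len, zero_len]
    split_ifs <;> omega

/-- The monoidal structure `[m] ⊗ [n] = [m + n]` with unit `[0]`. -/
instance : MonoidalCategory FinInt :=
  MonoidalCategory.mk (toMonoidalCategoryStruct :=
    { tensorObj := sum
      whiskerLeft := fun m _ _ f => sumMap (𝟙 m) f
      whiskerRight := fun f n => sumMap f (𝟙 n)
      tensorHom := fun f g => sumMap f g
      tensorUnit := zero
      associator := fun m n l => castIso (Nat.add_assoc m.len n.len l.len)
      leftUnitor := fun m => castIso (Nat.zero_add m.len)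
      rightUnitor := fun m => castIso (Nat.add_zero m.len) })
    (tensorHom_def := fun f g => by simp [sumMap_comp])
    (id_tensorHom_id := sumMap_id)
    (tensorHom_comp_tensorHom := fun f₁ f₂ g₁ g₂ => sumMap_comp f₁ f₂ g₁ g₂)
    (whiskerLeft_id := sumMap_id)
    (id_whiskerRight := sumMap_id)
    (associator_naturality := fun f₁ f₂ f₃ => associator_naturality_aux f₁ f₂ f₃
      (Nat.add_assoc _ _ _) (Nat.add_assoc _ _ _))
    (leftUnitor_naturality := fun f => leftUnitor_naturality_aux f (Nat.zero_add _)
      (Nat.zero_add _))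
    (rightUnitor_naturality := fun f => rightUnitor_naturality_aux f (Nat.add_zero _)
      (Nat.add_zero _))
    (pentagon := fun m n l j => pentagon_aux m n l j (Nat.add_assoc _ _ _) (Nat.add_assoc _ _ _)
      (Nat.add_assoc _ _ _) (Nat.add_assoc _ _ _) (Nat.add_assoc _ _ _))
    (triangle := fun m n => triangle_aux m n (Nat.add_assoc _ _ _) (Nat.zero_add _)
      (Nat.add_zero _))

/-! The monoidal structure in terms of `sumMap` and `castHom`. -/

theorem tensorHom_eq {m n m' n' : FinInt} (f : m ⟶ n) (g : m' ⟶ n') : f ⊗ₘ g = sumMap f g := rfl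
theorem whiskerLeft_eq (m : FinInt) {n n' : FinInt} (f : n ⟶ n') : m ◁ f = sumMap (𝟙 m) f := rfl
theorem whiskerRight_eq {m m' : FinInt} (f : m ⟶ m') (n : FinInt) : f ▷ n = sumMap f (𝟙 n) := rfl

end FinInt

end FiniteIntervals

/-! ### The 2-category of labelled finite intervals -/

section Paths

/-- A sequence `(a₀, …, aₙ)` of elements of `S` with `a₀ = a` and `aₙ = b`. -/
structure Path (S : Type u) (n : FinInt) (a b : S) where
  /-- the sequence -/
  seq : Fin (n.len + 1) → S
  seq_zero : seq 0 = a
  seq_last : seq (Fin.last n.len) = b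

namespace Path

variable {S T : Type u} {l m n : FinInt} {a b c d : S}

/-- The entry `aᵢ`, extended by `aᵢ = aₙ` for `i > n`. -/
def nat (p : Path S n a b) (i : ℕ) : S := p.seq ⟨min i n.len, by omega⟩

theorem nat_val (p : Path S n a b) (i : Fin (n.len + 1)) : p.nat i.val = p.seq i := by
  have := i.2
  rw [nat]
  congr 1
  apply Fin.ext
  simp only
  omega

theorem ext_nat {p q : Path S n a b} (h : ∀ i, p.nat i = q.nat i) : p = q := by
  obtain ⟨s, _, _⟩ := p
  obtain ⟨t, _, _⟩ := q
  obtain rfl : s = t := funext fun i => by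
    have := h i.val
    rwa [nat_val, nat_val] at this
  rfl

@[simp] theorem nat_zero (p : Path S n a b) : p.nat 0 = a := by
  refine Eq.trans ?_ p.seq_zero
  rw [nat]
  congr 1

theorem nat_last (p : Path S n a b) {i : ℕ} (h : n.len ≤ i) : p.nat i = b := by
  refine Eq.trans ?_ p.seq_last
  rw [nat]
  congr 1
  apply Fin.ext
  simpa using h

/-- A path from its entries. -/
def mk' (s : ℕ → S) (h0 : s 0 = a) (hl : s n.len = b) : Path S n a b := ⟨fun i => s i.val, h0, hl⟩

theorem nat_mk' (s : ℕ → S) (h0 : s 0 = a) (hl : s n.len = b) (i : ℕ) :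
    (mk' (n := n) s h0 hl).nat i = s (min i n.len) := rfl

/-- The sequence `(a_{h(0)}, …, a_{h(m)})` for a morphism `h : [m] ⟶ [n]`. -/
def pull (h : m ⟶ n) (p : Path S n a b) : Path S m a b :=
  ⟨fun i => p.seq (h.toFun i), by rw [h.map_zero, p.seq_zero], by rw [h.map_last, p.seq_last]⟩

theorem nat_pull (h : m ⟶ n) (p : Path S n a b) (i : ℕ) : (pull h p).nat i = p.nat (h.nat i) := by
  by_cases hi : i ≤ m.len
  · rw [nat, pull]
    dsimp only
    rw [← nat_val, FinInt.Hom.nat_val]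
    simp only [Nat.min_eq_left hi]
  · obtain ⟨j, rfl⟩ := Nat.exists_eq_add_of_le (Nat.le_of_not_le hi)
    rw [nat_last _ (by omega), h.nat_add, nat_last _ (by omega)]

/-- The one-term sequence `(a)`. -/
def const (a : S) : Path S FinInt.zero a a := ⟨fun _ => a, rfl, rfl⟩

@[simp] theorem nat_const (a : S) (i : ℕ) : (const a).nat i = a := rfl

/-- The concatenation `(a₀, …, aₘ = b₀, …, bₙ)` of two sequences. -/
def concat (p : Path S m a b) (q : Path S n b c) : Path S (FinInt.sum m n) a c where
  seq i := if h : i.val ≤ m.len then p.seq ⟨i.val, by omega⟩ else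
    q.seq ⟨i.val - m.len, by have := i.2; simp only [FinInt.sum_len] at this; omega⟩
  seq_zero := by
    rw [dif_pos (by simp)]
    exact p.seq_zero
  seq_last := by
    split_ifs with h
    · simp only [FinInt.sum_len, Fin.val_last] at h
      have h1 := p.nat_last (i := m.len) le_rfl
      have h2 := q.nat_last (i := 0) (by omega)
      rw [nat_zero] at h2
      rw [← nat_val]
      rw [p.nat_last (by simp), h2]
    · rw [← nat_val, q.nat_last (by simp)]

theorem nat_concat (p : Path S m a b) (q : Path S n b c) (i : ℕ) :
    (concat p q).nat i = if i ≤ m.len then p.nat i else q.nat (i - m.len) := by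
  by_cases hi : i ≤ m.len + n.len
  · rw [nat, concat]
    simp only [FinInt.sum_len, Nat.min_eq_left hi]
    split_ifs with h
    · exact (nat_val p _).symm
    · exact (nat_val q _).symm
  · rw [if_neg (by omega), nat_last _ (by rw [FinInt.sum_len]; omega), nat_last _ (by omega)]

theorem nat_concat_left (p : Path S m a b) (q : Path S n b c) {i : ℕ} (h : i ≤ m.len) :
    (concat p q).nat i = p.nat i := by
  rw [nat_concat, if_pos h]

theorem nat_concat_right (p : Path S m a b) (q : Path S n b c) (i : ℕ) :
    (concat p q).nat (m.len + i) = q.nat i := by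
  rw [nat_concat]
  split_ifs with h
  · obtain rfl : i = 0 := by omega
    rw [nat_zero, nat_last _ (by omega)]
  · simp

/-- The sequence `(f(a₀), …, f(aₙ))`. -/
def map (f : S → T) (p : Path S n a b) : Path T n (f a) (f b) :=
  ⟨fun i => f (p.seq i), by rw [p.seq_zero], by rw [p.seq_last]⟩

theorem nat_map (f : S → T) (p : Path S n a b) (i : ℕ) : (p.map f).nat i = f (p.nat i) := rfl

/-- The initial part `(a₀, …, aₘ)` of a sequence `(a₀, …, aₘ₊ₙ)`. -/
def take (p : Path S (FinInt.sum m n) a b) : Path S m a (p.nat m.len) :=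
  mk' p.nat p.nat_zero rfl

/-- The final part `(aₘ, …, aₘ₊ₙ)` of a sequence `(a₀, …, aₘ₊ₙ)`. -/
def drop (p : Path S (FinInt.sum m n) a b) : Path S n (p.nat m.len) b :=
  mk' (fun i => p.nat (m.len + i)) rfl (p.nat_last le_rfl)

theorem concat_take_drop (p : Path S (FinInt.sum m n) a b) : concat p.take p.drop = p :=
  ext_nat fun i => by
    rw [nat_concat, take, drop, nat_mk', nat_mk']
    split_ifs with h
    · rw [Nat.min_eq_left h]
    · by_cases h' : i - m.len ≤ n.len
      · rw [Nat.min_eq_left h', show m.len + (i - m.len) = i by omega]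
      · rw [nat_last _ (by rw [FinInt.sum_len]; omega), nat_last _ (by rw [FinInt.sum_len]; omega)]

theorem pull_sumMap {m' n' : FinInt} (f : m' ⟶ m) (g : n' ⟶ n) (p : Path S m a b)
    (q : Path S n b c) : pull (FinInt.sumMap f g) (concat p q) = concat (pull f p) (pull g q) :=
  ext_nat fun i => by
    rw [nat_pull, FinInt.nat_sumMap, nat_concat (pull f p)]
    split_ifs with h
    · rw [nat_concat_left _ _ (f.nat_le h), nat_pull]
    · rw [nat_concat_right, nat_pull]

theorem pull_id (p : Path S n a b) : pull (𝟙 n) p = p := rfl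

theorem pull_comp (f : l ⟶ m) (g : m ⟶ n) (p : Path S n a b) :
    pull (f ≫ g) p = pull f (pull g p) := rfl

theorem map_concat (f : S → T) (p : Path S m a b) (q : Path S n b c) :
    (concat p q).map f = concat (p.map f) (q.map f) :=
  ext_nat fun i => by
    simp only [nat_map, nat_concat]
    split_ifs <;> rfl

theorem map_pull (f : S → T) (h : m ⟶ n) (p : Path S n a b) :
    (pull h p).map f = pull h (p.map f) := rfl

end Path

/-- The 1-morphisms `a ⟶ b` of the 2-category `𝒫_S`: sequences `(a₀, …, aₙ)` with `a₀ = a`,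
`aₙ = b` and `n ≥ 0`. -/
structure Chain (S : Type u) (a b : S) where
  /-- the interval `[n]` -/
  len : FinInt
  /-- the sequence -/
  path : Path S len a b

namespace Chain

variable {S T : Type u} {a b c d : S}

/-- The 2-morphisms `(a₀, …, aₙ) ⟶ (b₀, …, bₘ)` of `𝒫_S`: morphisms `h : [m] ⟶ [n]` of finite
intervals such that `bᵢ = a_{h(i)}` for all `i`. -/
structure Hom (p q : Chain S a b) where
  /-- the morphism of finite intervals -/
  hom : q.len ⟶ p.len
  comm : Path.pull hom p.path = q.path

instance : Category (Chain S a b) where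
  Hom := Hom
  id p := ⟨𝟙 p.len, rfl⟩
  comp f g := ⟨g.hom ≫ f.hom, by rw [Path.pull_comp, f.comm, g.comm]⟩

theorem hom_ext {p q : Chain S a b} {f g : p ⟶ q} (h : f.hom = g.hom) : f = g := by
  obtain ⟨f, _⟩ := f
  obtain ⟨g, _⟩ := g
  obtain rfl : f = g := h
  rfl

theorem hom_ext_nat {p q : Chain S a b} {f g : p ⟶ q} (h : ∀ i, f.hom.nat i = g.hom.nat i) :
    f = g := hom_ext (FinInt.hom_ext h)

@[simp] theorem id_hom (p : Chain S a b) : Hom.hom (𝟙 p) = 𝟙 p.len := rfl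

@[simp] theorem comp_hom {p q r : Chain S a b} (f : p ⟶ q) (g : q ⟶ r) :
    (f ≫ g).hom = g.hom ≫ f.hom := rfl

/-- The identity `(a)`. -/
abbrev one (a : S) : Chain S a a := ⟨FinInt.zero, Path.const a⟩

/-- The composition: concatenation of sequences. -/
abbrev mul (p : Chain S a b) (q : Chain S b c) : Chain S a c :=
  ⟨FinInt.sum p.len q.len, Path.concat p.path q.path⟩

/-- The horizontal composition of 2-morphisms. -/
def mulMap {p p' : Chain S a b} {q q' : Chain S b c} (f : p ⟶ p') (g : q ⟶ q') :
    mul p q ⟶ mul p' q' :=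
  ⟨FinInt.sumMap f.hom g.hom, by
    have := Path.pull_sumMap f.hom g.hom p.path q.path
    rw [f.comm, g.comm] at this
    exact this⟩

/-- The 2-morphism given by the map `i ↦ i`, between sequences with the same entries. -/
def castHom {p q : Chain S a b} (h : p.len.len = q.len.len) (h' : ∀ i, p.path.nat i = q.path.nat i) :
    p ⟶ q :=
  ⟨FinInt.castHom h.symm, Path.ext_nat fun i => by rw [Path.nat_pull, FinInt.nat_castHom, h']⟩

/-- The invertible 2-morphism given by the map `i ↦ i`, between sequences with the same entries. -/
def castIso {p q : Chain S a b} (h : p.len.len = q.len.len) (h' : ∀ i, p.path.nat i = q.path.nat i) :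
    p ≅ q where
  hom := castHom h h'
  inv := castHom h.symm fun i => (h' i).symm
  hom_inv_id := hom_ext (FinInt.castIso h).hom_inv_id
  inv_hom_id := hom_ext (FinInt.castIso h).inv_hom_id

/-- `(pq)r` and `p(qr)` have the same entries. -/
theorem mul_assoc_nat (p : Chain S a b) (q : Chain S b c) (r : Chain S c d) (i : ℕ) :
    (mul (mul p q) r).path.nat i = (mul p (mul q r)).path.nat i := by
  simp only [mul, Path.nat_concat, FinInt.sum_len, Nat.sub_sub]
  split_ifs <;> first | rfl | omega

theorem one_mul_nat (p : Chain S a b) (i : ℕ) : (mul (one a) p).path.nat i = p.path.nat i := by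
  have h := Path.nat_concat_right (Path.const a) p.path i
  rwa [FinInt.zero_len, Nat.zero_add] at h

theorem mul_one_nat (p : Chain S a b) (i : ℕ) : (mul p (one b)).path.nat i = p.path.nat i := by
  simp only [mul, one, Path.nat_concat, Path.nat_const]
  split_ifs with h
  · rfl
  · rw [Path.nat_last _ (by omega)]

/-- The sequence `(f(a₀), …, f(aₙ))`. -/
abbrev map (f : S → T) (p : Chain S a b) : Chain T (f a) (f b) := ⟨p.len, p.path.map f⟩

/-- The action of a map of sets on 2-morphisms. -/
def mapHom (f : S → T) {p q : Chain S a b} (h : p ⟶ q) : p.map f ⟶ q.map f :=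
  ⟨h.hom, by
    change Path.pull h.hom (p.path.map f) = q.path.map f
    rw [← Path.map_pull, h.comm]⟩

end Chain

/-- The objects of the 2-category `𝒫_S` of labelled finite intervals: the elements of `S`. -/
structure PathCat (S : Type u) where
  /-- the underlying element -/
  pt : S

instance (S : Type u) : Bicategory (PathCat S) where
  Hom a b := Chain S a.pt b.pt
  id a := Chain.one a.pt
  comp p q := Chain.mul p q
  homCategory _ _ := inferInstance
  whiskerLeft p _ _ f := Chain.mulMap (𝟙 p) f
  whiskerRight f q := Chain.mulMap f (𝟙 q)
  associator p q r := Chain.castIso (Nat.add_assoc _ _ _) (Chain.mul_assoc_nat p q r)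
  leftUnitor p := Chain.castIso (Nat.zero_add _) (Chain.one_mul_nat p)
  rightUnitor p := Chain.castIso (Nat.add_zero _) (Chain.mul_one_nat p)
  whiskerLeft_id p q := Chain.hom_ext (MonoidalCategory.whiskerLeft_id p.len q.len)
  whiskerLeft_comp p _ _ _ f g :=
    Chain.hom_ext (MonoidalCategory.whiskerLeft_comp p.len g.hom f.hom)
  id_whiskerLeft f := Chain.hom_ext ((MonoidalCategory.id_whiskerLeft f.hom).trans
    (Category.assoc _ _ _).symm)
  comp_whiskerLeft p q _ _ f := Chain.hom_ext
    ((MonoidalCategory.tensor_whiskerLeft p.len q.len f.hom).trans (Category.assoc _ _ _).symm)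
  id_whiskerRight p q := Chain.hom_ext (MonoidalCategory.id_whiskerRight p.len q.len)
  comp_whiskerRight f g q :=
    Chain.hom_ext (MonoidalCategory.comp_whiskerRight g.hom f.hom q.len)
  whiskerRight_id f := Chain.hom_ext ((MonoidalCategory.whiskerRight_id f.hom).trans
    (Category.assoc _ _ _).symm)
  whiskerRight_comp f p q := Chain.hom_ext
    ((MonoidalCategory.whiskerRight_tensor f.hom p.len q.len).trans (Category.assoc _ _ _).symm)
  whisker_assoc p _ _ f q := Chain.hom_ext
    ((MonoidalCategory.whisker_assoc p.len f.hom q.len).trans (Category.assoc _ _ _).symm)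
  whisker_exchange f g := Chain.hom_ext (MonoidalCategory.whisker_exchange f.hom g.hom).symm
  pentagon _ _ _ _ := Chain.hom_ext ((Category.assoc _ _ _).trans
    (MonoidalCategory.pentagon_inv (C := FinInt)))
  triangle p q := Chain.hom_ext (MonoidalCategory.triangle_assoc_comp_left_inv p.len q.len)

end Paths

/-! ### Templicial modules -/

namespace Quiv

variable {k : Type u} [CommRing k] {S T : Type u}

/-- For quivers `Q, P` on `S`, `Q', P'` on `T` and a map `f : S → T`, the composite
`Q ⊗ P ⟶ f^* Q' ⊗ f^* P' ⟶ f^* (Q' ⊗ P')` of `u ⊗ v` with the lax structure of `f^*`, where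
`(f^* Q')(a, b) = Q'(f a, f b)`. -/
def tensAlong (f : S → T) {Q P : Quiv k S} {Q' P' : Quiv k T} (u : ∀ a b, Q a b ⟶ Q' (f a) (f b))
    (v : ∀ a b, P a b ⟶ P' (f a) (f b)) (a b : S) : tens Q P a b ⟶ tens Q' P' (f a) (f b) :=
  tensDesc fun c => (u a c ⊗ₘ v c b) ≫ tensInc Q' P' (f a) (f c) (f b)

/-- The lax structure morphism `I_S ⟶ f^* I_T`. -/
def unitAlong (k : Type u) [CommRing k] (f : S → T) (a b : S) :
    unit k S a b ⟶ unit k T (f a) (f b) :=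
  unitDesc fun h => unitInc (congrArg f h)

@[simp] theorem tensInc_along (f : S → T) {Q P : Quiv k S} {Q' P' : Quiv k T}
    (u : ∀ a b, Q a b ⟶ Q' (f a) (f b)) (v : ∀ a b, P a b ⟶ P' (f a) (f b)) (a c b : S) :
    tensInc Q P a c b ≫ tensAlong f u v a b =
      (u a c ⊗ₘ v c b) ≫ tensInc Q' P' (f a) (f c) (f b) := tensInc_desc _ c

@[simp] theorem tensInc_along_assoc (f : S → T) {Q P : Quiv k S} {Q' P' : Quiv k T}
    (u : ∀ a b, Q a b ⟶ Q' (f a) (f b)) (v : ∀ a b, P a b ⟶ P' (f a) (f b)) (a c b : S) {Z : ModuleCat.{u} k} (z : _ ⟶ Z) :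
    tensInc Q P a c b ≫ tensAlong f u v a b ≫ z =
      (u a c ⊗ₘ v c b) ≫ tensInc Q' P' (f a) (f c) (f b) ≫ z := by
  rw [reassoc_of% @tensInc_along]

@[simp] theorem unitInc_along (f : S → T) {a b : S} (h : a = b) :
    unitInc (k := k) h ≫ unitAlong k f a b = unitInc (congrArg f h) := unitInc_desc _ h

@[simp] theorem unitInc_along_assoc (f : S → T) {a b : S} (h : a = b) {Z : ModuleCat.{u} k} (z : _ ⟶ Z) :
    unitInc (k := k) h ≫ unitAlong k f a b ≫ z =
      unitInc (congrArg f h) ≫ z := by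
  rw [reassoc_of% @unitInc_along]

theorem tensAlong_id (Q P : Quiv k S) (a b : S) :
    tensAlong id (fun a b => 𝟙 (Q a b)) (fun a b => 𝟙 (P a b)) a b = 𝟙 (tens Q P a b) :=
  tens_ext fun c => by
    rw [tensInc_along, Category.comp_id]
    exact (congrArg (· ≫ _) (id_tensorHom_id _ _)).trans (Category.id_comp _)

theorem unitAlong_id (a b : S) : unitAlong k id a b = 𝟙 (unit k S a b) :=
  unit_ext fun h => by
    rw [unitInc_along, Category.comp_id]

theorem tensAlong_comp {U : Type u} (f : S → T) (g : T → U) {Q P : Quiv k S} {Q' P' : Quiv k T}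
    {Q'' P'' : Quiv k U} (u : ∀ a b, Q a b ⟶ Q' (f a) (f b)) (v : ∀ a b, P a b ⟶ P' (f a) (f b))
    (u' : ∀ a b, Q' a b ⟶ Q'' (g a) (g b)) (v' : ∀ a b, P' a b ⟶ P'' (g a) (g b)) (a b : S) :
    tensAlong f u v a b ≫ tensAlong g u' v' (f a) (f b) =
      tensAlong (g ∘ f) (Q' := Q'') (P' := P'') (fun a b => u a b ≫ u' (f a) (f b))
        (fun a b => v a b ≫ v' (f a) (f b)) a b :=
  tens_ext fun c => by
    rw [tensInc_along_assoc, tensInc_along, tensInc_along]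
    exact tensorHom_comp_tensorHom_assoc _ _ _ _ _

theorem unitAlong_comp {U : Type u} (f : S → T) (g : T → U) (a b : S) :
    unitAlong k f a b ≫ unitAlong k g (f a) (f b) = unitAlong k (g ∘ f) a b :=
  unit_ext fun h => by
    rw [unitInc_along_assoc, unitInc_along, unitInc_along]

theorem isIso_of_app {Q P : Quiv k S} (f : Q ⟶ P) (h : ∀ a b, IsIso (f.app a b)) : IsIso f :=
  ⟨⟨fun a b => inv (f.app a b)⟩, hom_ext fun a b => IsIso.hom_inv_id (f.app a b),
    hom_ext fun a b => IsIso.inv_hom_id (f.app a b)⟩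

end Quiv

open Functor.OplaxMonoidal in
/-- A templicial module: a set `S` with a strongly unital, colax monoidal functor from the opposite
of the category of finite intervals to the category of `Mod(k)`-enriched quivers on `S`. -/
structure TempMod (k : Type u) [CommRing k] where
  /-- the set of vertices -/
  vert : Type u
  /-- the underlying functor -/
  func : FinIntᵒᵖ ⥤ Quiv k vert
  [colax : func.OplaxMonoidal]
  [unital : IsIso (η func)]

namespace TempMod

attribute [instance] TempMod.colax TempMod.unital

variable {k : Type u} [CommRing k]

/-- The quiver `Xₙ` of `n`-simplices, with components `Xₙ(a, b)`. -/
abbrev quiv (X : TempMod k) (n : FinInt) : Quiv k X.vert := X.func.obj (op n)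

/-- The map `Xₙ(a, b) ⟶ Xₘ(a, b)` induced by a morphism of finite intervals `[m] ⟶ [n]`. -/
def act (X : TempMod k) {m n : FinInt} (h : m ⟶ n) (a b : X.vert) : X.quiv n a b ⟶ X.quiv m a b :=
  (X.func.map h.op).app a b

/-- The comultiplication `μ : Xₘ₊ₙ(a, b) ⟶ ⨁ c, Xₘ(a, c) ⊗ Xₙ(c, b)`. -/
def comult (X : TempMod k) (m n : FinInt) (a b : X.vert) :
    X.quiv (m ⊗ n) a b ⟶ Quiv.tens (X.quiv m) (X.quiv n) a b :=
  (Functor.OplaxMonoidal.δ X.func (op m) (op n)).app a b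

/-- The counit `ε : X₀(a, b) ⟶ I_S(a, b)`. -/
def counit (X : TempMod k) (a b : X.vert) : X.quiv (𝟙_ FinInt) a b ⟶ Quiv.unit k X.vert a b :=
  (Functor.OplaxMonoidal.η X.func).app a b

/-- A morphism of templicial modules `(X, S) ⟶ (Y, T)`: a map `f : S → T` and a monoidal natural
transformation `f_! X ⟶ Y`, given by its components `Xₙ(a, b) ⟶ Yₙ(f a, f b)`. In terms of the
right adjoint `f^*` of `f_!` this is a natural transformation `X ⟶ f^* Y` which is compatible with
the comultiplications and counits. -/
structure Hom (X Y : TempMod k) where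
  /-- the map on vertices -/
  f : X.vert → Y.vert
  /-- the components -/
  app : ∀ (n : FinInt) (a b : X.vert), X.quiv n a b ⟶ Y.quiv n (f a) (f b)
  naturality : ∀ {m n : FinInt} (h : m ⟶ n) (a b : X.vert),
    X.act h a b ≫ app m a b = app n a b ≫ Y.act h (f a) (f b)
  comult : ∀ (m n : FinInt) (a b : X.vert),
    X.comult m n a b ≫ Quiv.tensAlong f (app m) (app n) a b =
      app (m ⊗ n) a b ≫ Y.comult m n (f a) (f b)
  counit : ∀ a b : X.vert,
    X.counit a b ≫ Quiv.unitAlong k f a b = app (𝟙_ FinInt) a b ≫ Y.counit (f a) (f b)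

theorem Hom.ext' {X Y : TempMod k} {α β : Hom X Y} (h : α.f = β.f)
    (h' : ∀ n a b, α.app n a b ≫ eqToHom (by rw [h]) = β.app n a b) : α = β := by
  obtain ⟨f, α, _, _, _⟩ := α
  obtain ⟨g, β, _, _, _⟩ := β
  dsimp only at h
  subst h
  obtain rfl : α = β := by
    funext n a b
    simpa using h' n a b
  rfl

/-- The category of templicial modules. -/
instance : Category (TempMod k) where
  Hom := Hom
  id X :=
    { f := id
      app := fun n a b => 𝟙 (X.quiv n a b)
      naturality := fun h a b => by
        rw [Category.id_comp]
        exact Category.comp_id _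
      comult := fun m n a b => by
        rw [Category.id_comp, Quiv.tensAlong_id]
        exact Category.comp_id _
      counit := fun a b => by
        rw [Category.id_comp, Quiv.unitAlong_id]
        exact Category.comp_id _ }
  comp {X Y Z} α β :=
    { f := β.f ∘ α.f
      app := fun n a b => α.app n a b ≫ β.app n (α.f a) (α.f b)
      naturality := fun h a b => by
        rw [← Category.assoc, α.naturality, Category.assoc, β.naturality, Category.assoc]
        rfl
      comult := fun m n a b => by
        rw [← Quiv.tensAlong_comp, reassoc_of% (α.comult m n a b), β.comult, Category.assoc]
        rfl
      counit := fun a b => by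
        rw [← Quiv.unitAlong_comp, reassoc_of% (α.counit a b), β.counit, Category.assoc]
        rfl }
  id_comp α := Hom.ext' rfl fun n a b => (Category.comp_id _).trans (Category.id_comp _)
  comp_id α := Hom.ext' rfl fun n a b => (Category.comp_id _).trans (Category.comp_id _)
  assoc α β γ := Hom.ext' rfl fun n a b => (Category.comp_id _).trans (Category.assoc _ _ _)

end TempMod

/-! ### Enriched precategories -/

namespace Chain

variable {S T : Type u} {a b c : S}

/-- The 2-morphism `f(pq) ⟶ f(p)f(q)`; both sequences have the same entries. -/
def mapMul (f : S → T) (p : Chain S a b) (q : Chain S b c) :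
    (mul p q).map f ⟶ mul (p.map f) (q.map f) :=
  castHom rfl fun i => congrArg (fun r => Path.nat r i) (Path.map_concat f p.path q.path)

/-- The 2-morphism `f((a)) ⟶ (f(a))`; both sequences have the same entries. -/
def mapOne (f : S → T) (a : S) : (one a).map f ⟶ one (f a) := castHom rfl fun _ => rfl

end Chain

/-- A precategory enriched in `Mod(k)`: a set `S` with a strongly unital, colax functor of
bicategories from the 2-category `𝒫_S` of labelled finite intervals to `Mod(k)`, considered as a
bicategory with one object. -/
structure PreCat (k : Type u) [CommRing k] where
  /-- the set of objects -/
  vert : Type u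
  /-- the underlying colax functor -/
  func : OplaxFunctor (PathCat vert) (MonoidalSingleObj (ModuleCat.{u} k))
  [unital : ∀ a, IsIso (func.mapId a)]

namespace PreCat

variable {k : Type u} [CommRing k]

/-- The module `X(a₀, …, aₙ)`. -/
def obj (X : PreCat k) {a b : X.vert} (p : Chain X.vert a b) : ModuleCat.{u} k :=
  X.func.map (X := ⟨a⟩) (Y := ⟨b⟩) p

/-- The map `X(a₀, …, aₙ) ⟶ X(a_{h(0)}, …, a_{h(m)})` for `h : [m] ⟶ [n]`. -/
def act (X : PreCat k) {a b : X.vert} {p q : Chain X.vert a b} (h : p ⟶ q) : X.obj p ⟶ X.obj q :=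
  X.func.map₂ (a := ⟨a⟩) (b := ⟨b⟩) h

/-- The comultiplication
`X(a₀, …, aₘ = b₀, …, bₙ) ⟶ X(a₀, …, aₘ) ⊗ X(b₀, …, bₙ)`. -/
def comult (X : PreCat k) {a b c : X.vert} (p : Chain X.vert a b) (q : Chain X.vert b c) :
    X.obj (Chain.mul p q) ⟶ X.obj p ⊗ X.obj q :=
  X.func.mapComp (a := ⟨a⟩) (b := ⟨b⟩) (c := ⟨c⟩) p q

/-- The counit `X(a) ⟶ k`. -/
def counit (X : PreCat k) (a : X.vert) : X.obj (Chain.one a) ⟶ 𝟙_ (ModuleCat.{u} k) :=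
  X.func.mapId ⟨a⟩

section Laws

variable (X : PreCat k) {a b c d : X.vert}

@[simp] theorem act_id (p : Chain X.vert a b) : X.act (𝟙 p) = 𝟙 (X.obj p) :=
  X.func.map₂_id (a := ⟨a⟩) (b := ⟨b⟩) p

theorem act_comp {p q r : Chain X.vert a b} (f : p ⟶ q) (g : q ⟶ r) :
    X.act (f ≫ g) = X.act f ≫ X.act g :=
  X.func.map₂_comp (a := ⟨a⟩) (b := ⟨b⟩) f g

theorem act_comp_assoc {p q r : Chain X.vert a b} (f : p ⟶ q) (g : q ⟶ r) {Z : ModuleCat.{u} k} (z : _ ⟶ Z) :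
    X.act (f ≫ g) ≫ z =
      X.act f ≫ X.act g ≫ z := by
  rw [reassoc_of% @act_comp]

theorem act_mulMap {p p' : Chain X.vert a b} {q q' : Chain X.vert b c} (f : p ⟶ p') (g : q ⟶ q') :
    X.act (Chain.mulMap f g) ≫ X.comult p' q' = X.comult p q ≫ (X.act f ⊗ₘ X.act g) := by
  have h : Chain.mulMap f g = Chain.mulMap f (𝟙 q) ≫ Chain.mulMap (𝟙 p') g :=
    Chain.hom_ext (MonoidalCategory.tensorHom_def' f.hom g.hom)
  have h1 : X.act (Chain.mulMap f (𝟙 q)) ≫ X.comult p' q = X.comult p q ≫ X.act f ▷ X.obj q :=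
    X.func.mapComp_naturality_left (a := ⟨a⟩) (b := ⟨b⟩) (c := ⟨c⟩) f q
  have h2 : X.act (Chain.mulMap (𝟙 p') g) ≫ X.comult p' q' =
      X.comult p' q ≫ X.obj p' ◁ X.act g :=
    X.func.mapComp_naturality_right (a := ⟨a⟩) (b := ⟨b⟩) (c := ⟨c⟩) p' g
  rw [h, act_comp, Category.assoc, h2, reassoc_of% h1, MonoidalCategory.tensorHom_def]

theorem act_mulMap_assoc {p p' : Chain X.vert a b} {q q' : Chain X.vert b c} (f : p ⟶ p') (g : q ⟶ q') {Z : ModuleCat.{u} k} (z : _ ⟶ Z) :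
    X.act (Chain.mulMap f g) ≫ X.comult p' q' ≫ z =
      X.comult p q ≫ (X.act f ⊗ₘ X.act g) ≫ z := by
  rw [reassoc_of% @act_mulMap]

theorem comult_assoc (p : Chain X.vert a b) (q : Chain X.vert b c) (r : Chain X.vert c d) :
    X.act (Chain.castIso (Nat.add_assoc _ _ _) (Chain.mul_assoc_nat p q r)).hom ≫
        X.comult p (q.mul r) ≫ X.obj p ◁ X.comult q r =
      X.comult (p.mul q) r ≫ X.comult p q ▷ X.obj r ≫
        (α_ (X.obj p) (X.obj q) (X.obj r)).hom :=
  X.func.map₂_associator (a := ⟨a⟩) (b := ⟨b⟩) (c := ⟨c⟩) (d := ⟨d⟩) p q r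

theorem comult_one (p : Chain X.vert a b) :
    X.act (Chain.castIso (Nat.zero_add _) (Chain.one_mul_nat p)).hom =
      X.comult (Chain.one a) p ≫ X.counit a ▷ X.obj p ≫ (λ_ (X.obj p)).hom :=
  X.func.map₂_leftUnitor (a := ⟨a⟩) (b := ⟨b⟩) p

theorem one_comult (p : Chain X.vert a b) :
    X.act (Chain.castIso (p := p.mul (Chain.one b)) (q := p) (Nat.add_zero _)
        (Chain.mul_one_nat p)).hom =
      X.comult p (Chain.one b) ≫ X.obj p ◁ X.counit b ≫ (ρ_ (X.obj p)).hom :=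
  X.func.map₂_rightUnitor (a := ⟨a⟩) (b := ⟨b⟩) p

instance (a : X.vert) : IsIso (X.counit a) := X.unital ⟨a⟩

end Laws

/-- A morphism of enriched precategories `(X, S) ⟶ (Y, T)`: a map `f : S → T` with linear maps
`X(a₀, …, aₙ) ⟶ Y(f(a₀), …, f(aₙ))` which are natural and compatible with the comultiplications
and counits (a colax transformation `X ⟶ Y ∘ 𝒫_f` whose components at objects are identities). -/
structure Hom (X Y : PreCat k) where
  /-- the map on objects -/
  f : X.vert → Y.vert
  /-- the components -/
  app : ∀ {a b : X.vert} (p : Chain X.vert a b), X.obj p ⟶ Y.obj (p.map f)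
  naturality : ∀ {a b : X.vert} {p q : Chain X.vert a b} (h : p ⟶ q),
    X.act h ≫ app q = app p ≫ Y.act (Chain.mapHom f h)
  comult : ∀ {a b c : X.vert} (p : Chain X.vert a b) (q : Chain X.vert b c),
    X.comult p q ≫ (app p ⊗ₘ app q) =
      app (p.mul q) ≫ Y.act (Chain.mapMul f p q) ≫ Y.comult (p.map f) (q.map f)
  counit : ∀ a : X.vert,
    X.counit a = app (Chain.one a) ≫ Y.act (Chain.mapOne f a) ≫ Y.counit (f a)

theorem Hom.ext' {X Y : PreCat k} {α β : Hom X Y} (h : α.f = β.f)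
    (h' : ∀ {a b : X.vert} (p : Chain X.vert a b), HEq (α.app p) (β.app p)) : α = β := by
  obtain ⟨f, α, _, _, _⟩ := α
  obtain ⟨g, β, _, _, _⟩ := β
  dsimp only at h
  subst h
  obtain rfl : @α = @β := by
    funext a b p
    exact eq_of_heq (h' p)
  rfl

/-- The category of enriched precategories. -/
instance : Category (PreCat k) where
  Hom := Hom
  id X :=
    { f := id
      app := fun p => 𝟙 (X.obj p)
      naturality := fun h => (Category.comp_id _).trans (Category.id_comp _).symm
      comult := fun p q => by
        have h : Chain.mapMul id p q = 𝟙 _ := Chain.hom_ext (FinInt.hom_ext fun i =>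
          (FinInt.nat_castHom rfl i).trans (FinInt.nat_id _ i).symm)
        rw [h]
        refine ((congrArg (_ ≫ ·) (id_tensorHom_id _ _)).trans (Category.comp_id _)).trans ?_
        refine Eq.trans ?_ (Category.id_comp _).symm
        refine Eq.trans ?_ (congrArg (· ≫ _) (X.act_id _).symm)
        exact (Category.id_comp _).symm
      counit := fun a => by
        have h : Chain.mapOne id a = 𝟙 _ := Chain.hom_ext (FinInt.hom_ext fun i =>
          (FinInt.nat_castHom rfl i).trans (FinInt.nat_id _ i).symm)
        rw [h]
        refine Eq.trans ?_ (Category.id_comp _).symm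
        refine Eq.trans ?_ (congrArg (· ≫ _) (X.act_id _).symm)
        exact (Category.id_comp _).symm }
  comp {X Y Z} α β :=
    { f := β.f ∘ α.f
      app := fun p => α.app p ≫ β.app (p.map α.f)
      naturality := fun {a b p q} h => by
        have h1 : X.act h ≫ α.app q ≫ β.app (q.map α.f) = (α.app p ≫ β.app (p.map α.f)) ≫
            Z.act (Chain.mapHom β.f (Chain.mapHom α.f h)) := by
          rw [← Category.assoc, α.naturality, Category.assoc, β.naturality, Category.assoc]
        exact h1
      comult := fun {a b c} p q => by
        have h : Chain.mapHom β.f (Chain.mapMul α.f p q) ≫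
            Chain.mapMul β.f (p.map α.f) (q.map α.f) = Chain.mapMul (β.f ∘ α.f) p q :=
          Chain.hom_ext (FinInt.hom_ext fun i => (FinInt.nat_comp _ _ i).trans
            (FinInt.nat_castHom rfl _))
        have h1 : X.comult p q ≫
            ((α.app p ≫ β.app (p.map α.f)) ⊗ₘ (α.app q ≫ β.app (q.map α.f))) =
            (α.app (p.mul q) ≫ β.app ((p.mul q).map α.f)) ≫
              Z.act (Chain.mapHom β.f (Chain.mapMul α.f p q) ≫
                Chain.mapMul β.f (p.map α.f) (q.map α.f)) ≫
              Z.comult ((p.map α.f).map β.f) ((q.map α.f).map β.f) := by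
          rw [← tensorHom_comp_tensorHom, reassoc_of% (α.comult p q), β.comult, act_comp,
            reassoc_of% (β.naturality (Chain.mapMul α.f p q))]
          simp only [Category.assoc]
        rw [h] at h1
        exact h1
      counit := fun a => by
        have h : Chain.mapHom β.f (Chain.mapOne α.f a) ≫ Chain.mapOne β.f (α.f a) =
            Chain.mapOne (β.f ∘ α.f) a :=
          Chain.hom_ext (FinInt.hom_ext fun i => (FinInt.nat_comp _ _ i).trans
            (FinInt.nat_castHom rfl _))
        have h1 : X.counit a =
            (α.app (Chain.one a) ≫ β.app ((Chain.one a).map α.f)) ≫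
              Z.act (Chain.mapHom β.f (Chain.mapOne α.f a) ≫ Chain.mapOne β.f (α.f a)) ≫
              Z.counit (β.f (α.f a)) := by
          rw [α.counit, β.counit, act_comp,
            reassoc_of% (β.naturality (Chain.mapOne α.f a))]
          simp only [Category.assoc]
        rw [h] at h1
        exact h1 }
  id_comp α := Hom.ext' rfl fun p => heq_of_eq (Category.id_comp _)
  comp_id α := Hom.ext' rfl fun p => heq_of_eq (Category.comp_id _)
  assoc α β γ := Hom.ext' rfl fun p => heq_of_eq (Category.assoc _ _ _)

end PreCat


/-! ### The comparison functor -/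

namespace PreCat

variable {k : Type u} [CommRing k]

section Objects

variable (X : PreCat k)

/-- The quiver `𝔠'(X)ₙ` with `𝔠'(X)ₙ(a, b) = ⨁ X(a, a₁, …, aₙ₋₁, b)`, the direct sum over all
sequences `(a₀, …, aₙ)` with `a₀ = a` and `aₙ = b`. For `n = 0` there is such a sequence only if
`a = b`, namely `(a)`. -/
def quiv (n : FinInt) : Quiv k X.vert :=
  ⟨fun a b => dsum fun p : Path X.vert n a b => X.obj ⟨n, p⟩⟩

variable {X} {n m l : FinInt} {a b c d : X.vert} {M : ModuleCat.{u} k}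

/-- The coprojection `X(a₀, …, aₙ) ⟶ 𝔠'(X)ₙ(a, b)`. -/
def quivInc (p : Path X.vert n a b) : X.obj ⟨n, p⟩ ⟶ X.quiv n a b :=
  inc (fun p : Path X.vert n a b => X.obj ⟨n, p⟩) p

/-- The morphism out of `𝔠'(X)ₙ(a, b)` with given components. -/
def quivDesc (f : ∀ p : Path X.vert n a b, X.obj ⟨n, p⟩ ⟶ M) : X.quiv n a b ⟶ M := desc f

@[simp] theorem quivInc_desc (f : ∀ p : Path X.vert n a b, X.obj ⟨n, p⟩ ⟶ M) (p : Path X.vert n a b) :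
    quivInc p ≫ quivDesc f = f p := inc_desc f p

@[simp] theorem quivInc_desc_assoc (f : ∀ p : Path X.vert n a b, X.obj ⟨n, p⟩ ⟶ M) (p : Path X.vert n a b) {Z : ModuleCat.{u} k} (z : _ ⟶ Z) :
    quivInc p ≫ quivDesc f ≫ z =
      f p ≫ z := by
  rw [reassoc_of% @quivInc_desc]

theorem quiv_ext {f g : X.quiv n a b ⟶ M}
    (h : ∀ p : Path X.vert n a b, quivInc p ≫ f = quivInc p ≫ g) : f = g := dsum_ext h

/-- The map `X(a₀, …, aₙ) ⟶ X(a_{h(0)}, …, a_{h(m)})`. -/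
def pullHom (h : m ⟶ n) (p : Path X.vert n a b) :
    (⟨n, p⟩ : Chain X.vert a b) ⟶ ⟨m, Path.pull h p⟩ := ⟨h, rfl⟩

variable (X) in
/-- The map `𝔠'(X)ₙ ⟶ 𝔠'(X)ₘ` for `h : [m] ⟶ [n]`, given by the maps
`X(a₀, …, aₙ) ⟶ X(a_{h(0)}, …, a_{h(m)})`. -/
def quivMap (h : m ⟶ n) : X.quiv n ⟶ X.quiv m :=
  ⟨fun _ _ => quivDesc fun p => X.act (pullHom h p) ≫ quivInc (Path.pull h p)⟩

theorem quivInc_map (h : m ⟶ n) (p : Path X.vert n a b) :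
    quivInc p ≫ (X.quivMap h).app a b = X.act (pullHom h p) ≫ quivInc (Path.pull h p) :=
  quivInc_desc _ p

theorem quivInc_map_assoc (h : m ⟶ n) (p : Path X.vert n a b) {Z : ModuleCat.{u} k} (z : _ ⟶ Z) :
    quivInc p ≫ (X.quivMap h).app a b ≫ z =
      X.act (pullHom h p) ≫ quivInc (Path.pull h p) ≫ z := by
  rw [reassoc_of% @quivInc_map]

/-- More flexibly, the target sequence may be given up to equality. -/
theorem quivInc_map' (h : m ⟶ n) (p : Path X.vert n a b) (q : Path X.vert m a b)
    (g : (⟨n, p⟩ : Chain X.vert a b) ⟶ ⟨m, q⟩) (hg : g.hom = h) :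
    quivInc p ≫ (X.quivMap h).app a b = X.act g ≫ quivInc q := by
  obtain ⟨g, hq⟩ := g
  change m ⟶ n at g
  obtain rfl : g = h := hg
  obtain rfl : Path.pull g p = q := hq
  exact quivInc_map _ _

theorem quivInc_map'_assoc (h : m ⟶ n) (p : Path X.vert n a b) (q : Path X.vert m a b)
    (g : (⟨n, p⟩ : Chain X.vert a b) ⟶ ⟨m, q⟩) (hg : g.hom = h) {Z : ModuleCat.{u} k} (z : _ ⟶ Z) :
    quivInc p ≫ (X.quivMap h).app a b ≫ z =
      X.act g ≫ quivInc q ≫ z := by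
  rw [reassoc_of% @quivInc_map']
  exact hg

variable (X) in
/-- The functor `𝔠'(X)`. -/
def quivFunctor : FinIntᵒᵖ ⥤ Quiv k X.vert where
  obj n := X.quiv n.unop
  map h := X.quivMap h.unop
  map_id n := Quiv.hom_ext fun a b => quiv_ext fun p =>
    (quivInc_map' _ p p (𝟙 _) rfl).trans (by
      rw [act_id, Category.id_comp]
      exact (Category.comp_id _).symm)
  map_comp {l m n} f g := Quiv.hom_ext fun a b => quiv_ext fun p => by
    refine (quivInc_map _ p).trans ?_
    refine Eq.trans ?_ (congrArg (quivInc p ≫ ·) (Quiv.comp_app _ _ a b).symm)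
    rw [quivInc_map_assoc, quivInc_map, ← act_comp_assoc]
    rfl

/-- The 2-morphism from a sequence `(a₀, …, aₘ₊ₙ)` to the concatenation of its parts. -/
def splitHom (p : Path X.vert (FinInt.sum m n) a b) :
    (⟨FinInt.sum m n, p⟩ : Chain X.vert a b) ⟶ Chain.mul ⟨m, p.take⟩ ⟨n, p.drop⟩ :=
  ⟨𝟙 (FinInt.sum m n), (Path.concat_take_drop p).symm⟩

variable (X) in
/-- The comultiplication of `𝔠'(X)`, given by the maps
`X(a₀, …, aₘ₊ₙ) ⟶ X(a₀, …, aₘ) ⊗ X(aₘ, …, aₘ₊ₙ)`. -/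
def quivComult (m n : FinInt) : X.quiv (FinInt.sum m n) ⟶ Quiv.tens (X.quiv m) (X.quiv n) :=
  ⟨fun a b => quivDesc fun p =>
    X.act (splitHom p) ≫ X.comult ⟨m, p.take⟩ ⟨n, p.drop⟩ ≫
      (quivInc p.take ⊗ₘ quivInc p.drop) ≫
        Quiv.tensInc (X.quiv m) (X.quiv n) a (p.nat m.len) b⟩

theorem quivInc_comult (p : Path X.vert (FinInt.sum m n) a b) (q : Path X.vert m a c)
    (r : Path X.vert n c b)
    (g : (⟨FinInt.sum m n, p⟩ : Chain X.vert a b) ⟶ Chain.mul ⟨m, q⟩ ⟨n, r⟩)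
    (hg : g.hom = 𝟙 (FinInt.sum m n)) :
    quivInc p ≫ (X.quivComult m n).app a b =
      X.act g ≫ X.comult ⟨m, q⟩ ⟨n, r⟩ ≫ (quivInc q ⊗ₘ quivInc r) ≫
        Quiv.tensInc (X.quiv m) (X.quiv n) a c b := by
  have hp : p = Path.concat q r := by
    obtain ⟨g, hp⟩ := g
    change FinInt.sum m n ⟶ FinInt.sum m n at g
    obtain rfl : g = 𝟙 _ := hg
    exact hp
  obtain rfl : p.nat m.len = c := by
    rw [hp, Path.nat_concat_left _ _ le_rfl, Path.nat_last _ le_rfl]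
  have hq : q = p.take := Path.ext_nat fun i => by
    rw [Path.take, Path.nat_mk']
    by_cases hi : i ≤ m.len
    · rw [Nat.min_eq_left hi, ← Path.nat_concat_left q r hi, ← hp]
    · rw [Nat.min_eq_right (by omega), Path.nat_last _ (by omega)]
  have hr : r = p.drop := Path.ext_nat fun i => by
    rw [Path.drop, Path.nat_mk']
    by_cases hi : i ≤ n.len
    · rw [Nat.min_eq_left hi, ← Path.nat_concat_right q r i, ← hp]
    · rw [Nat.min_eq_right (by omega), Path.nat_last _ (by omega), Path.nat_last _ (by simp)]
  subst hq hr
  obtain rfl : g = splitHom p := Chain.hom_ext hg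
  exact quivInc_desc _ p

theorem quivInc_comult_assoc (p : Path X.vert (FinInt.sum m n) a b) (q : Path X.vert m a c)
    (r : Path X.vert n c b)
    (g : (⟨FinInt.sum m n, p⟩ : Chain X.vert a b) ⟶ Chain.mul ⟨m, q⟩ ⟨n, r⟩)
    (hg : g.hom = 𝟙 (FinInt.sum m n)) {Z : ModuleCat.{u} k} (z : _ ⟶ Z) :
    quivInc p ≫ (X.quivComult m n).app a b ≫ z =
      X.act g ≫ X.comult ⟨m, q⟩ ⟨n, r⟩ ≫ (quivInc q ⊗ₘ quivInc r) ≫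
        Quiv.tensInc (X.quiv m) (X.quiv n) a c b ≫ z := by
  rw [reassoc_of% @quivInc_comult]
  exact hg

theorem quivInc_comult_concat (q : Path X.vert m a c) (r : Path X.vert n c b) :
    quivInc (Path.concat q r) ≫ (X.quivComult m n).app a b =
      X.comult ⟨m, q⟩ ⟨n, r⟩ ≫ (quivInc q ⊗ₘ quivInc r) ≫
        Quiv.tensInc (X.quiv m) (X.quiv n) a c b :=
  (quivInc_comult (Path.concat q r) q r (𝟙 (Chain.mul ⟨m, q⟩ ⟨n, r⟩)) rfl).trans (by
    rw [act_id, Category.id_comp])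

theorem quivInc_comult_concat_assoc (q : Path X.vert m a c) (r : Path X.vert n c b) {Z : ModuleCat.{u} k} (z : _ ⟶ Z) :
    quivInc (Path.concat q r) ≫ (X.quivComult m n).app a b ≫ z =
      X.comult ⟨m, q⟩ ⟨n, r⟩ ≫ (quivInc q ⊗ₘ quivInc r) ≫
        Quiv.tensInc (X.quiv m) (X.quiv n) a c b ≫ z := by
  rw [reassoc_of% @quivInc_comult_concat]

theorem quivComult_natural {m' n' : FinInt} (f : m' ⟶ m) (g : n' ⟶ n) :
    X.quivComult m n ≫ Quiv.tensMap (X.quivMap f) (X.quivMap g) =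
      X.quivMap (FinInt.sumMap f g) ≫ X.quivComult m' n' :=
  Quiv.hom_ext fun a b => quiv_ext fun p => by
    obtain ⟨c, q, r, rfl⟩ : ∃ (c : X.vert) (q : Path X.vert m a c) (r : Path X.vert n c b),
      p = Path.concat q r := ⟨_, p.take, p.drop, (Path.concat_take_drop p).symm⟩
    rw [Quiv.comp_app, Quiv.comp_app, quivInc_comult_concat_assoc, Quiv.tensInc_map,
      quivInc_map'_assoc (FinInt.sumMap f g) _ (Path.concat (Path.pull f q) (Path.pull g r))
        (Chain.mulMap (pullHom f q) (pullHom g r)) rfl, quivInc_comult_concat]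
    rw [tensorHom_comp_tensorHom_assoc, quivInc_map, quivInc_map,
      ← tensorHom_comp_tensorHom_assoc]
    exact (act_mulMap_assoc X (pullHom f q) (pullHom g r) _).symm

theorem quivComult_assoc (l m n : FinInt)
    (h : (FinInt.sum l (FinInt.sum m n)).len = (FinInt.sum (FinInt.sum l m) n).len) :
    X.quivComult (FinInt.sum l m) n ≫ Quiv.tensMap (X.quivComult l m) (𝟙 (X.quiv n)) ≫
        (Quiv.assoc (X.quiv l) (X.quiv m) (X.quiv n)).hom =
      X.quivMap (FinInt.castHom h) ≫ X.quivComult l (FinInt.sum m n) ≫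
        Quiv.tensMap (𝟙 (X.quiv l)) (X.quivComult m n) :=
  Quiv.hom_ext fun a b => quiv_ext fun p => by
    obtain ⟨d, p', s, rfl⟩ : ∃ (c : X.vert) (q : Path X.vert (FinInt.sum l m) a c)
      (r : Path X.vert n c b), p = Path.concat q r :=
        ⟨_, p.take, p.drop, (Path.concat_take_drop p).symm⟩
    obtain ⟨c, q, r, rfl⟩ : ∃ (c : X.vert) (q : Path X.vert l a c) (r : Path X.vert m c d),
      p' = Path.concat q r := ⟨_, p'.take, p'.drop, (Path.concat_take_drop p').symm⟩
    have h1 := X.comult_assoc ⟨l, q⟩ ⟨m, r⟩ ⟨n, s⟩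
    simp only [Quiv.comp_app]
    rw [quivInc_comult_concat_assoc, Quiv.tensInc_map_assoc, tensorHom_comp_tensorHom_assoc,
      quivInc_comult_concat, Quiv.id_app, Category.comp_id,
      quivInc_map'_assoc (FinInt.castHom h) _ (Path.concat q (Path.concat r s))
        (Chain.castIso (Nat.add_assoc _ _ _)
          (Chain.mul_assoc_nat (⟨l, q⟩ : Chain X.vert a c) ⟨m, r⟩ ⟨n, s⟩)).hom rfl,
      quivInc_comult_concat_assoc, Quiv.tensInc_map, tensorHom_comp_tensorHom_assoc,
      quivInc_comult_concat, Quiv.id_app, Category.comp_id]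
    rw [← whiskerRight_comp_tensorHom_assoc, ← tensorHom_comp_whiskerRight_assoc,
      Quiv.inc_assoc_hom, associator_naturality_assoc, ← whiskerLeft_comp_tensorHom_assoc,
      ← tensorHom_comp_whiskerLeft_assoc, reassoc_of% h1]

theorem eq_of_zero (p : Path X.vert FinInt.zero a b) : a = b :=
  p.seq_zero.symm.trans p.seq_last

theorem eq_const (p : Path X.vert FinInt.zero a a) : p = Path.const a :=
  Path.ext_nat fun _ => p.nat_last (Nat.zero_le _)

/-- The counit `X(a) ⟶ k`, for a sequence `(a₀)` with `a₀ = a` and `a₀ = b`. -/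
def zeroCounit : ∀ {a b : X.vert} (p : Path X.vert FinInt.zero a b),
    X.obj ⟨FinInt.zero, p⟩ ⟶ 𝟙_ (ModuleCat.{u} k) := fun {a b} p =>
  match b, eq_of_zero p, p with
  | _, rfl, p => X.act (Chain.castHom (p := ⟨FinInt.zero, p⟩) (q := Chain.one a) rfl fun i => by
      rw [eq_const p]) ≫ X.counit a

theorem zeroCounit_const (a : X.vert) : zeroCounit (Path.const a) = X.counit a := by
  have h : (Chain.castHom rfl fun _ => rfl : Chain.one a ⟶ Chain.one a) = 𝟙 _ :=
    Chain.hom_ext (FinInt.hom_ext fun i => (FinInt.nat_castHom rfl i).trans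
      (FinInt.nat_id _ i).symm)
  have h1 : X.act (Chain.castHom rfl fun _ => rfl : Chain.one a ⟶ Chain.one a) ≫ X.counit a =
      X.counit a := by
    rw [h, act_id, Category.id_comp]
  exact h1

variable (X) in
/-- The counit of `𝔠'(X)`, given by the maps `X(a) ⟶ k`. -/
def quivCounit : X.quiv FinInt.zero ⟶ Quiv.unit k X.vert :=
  ⟨fun _ _ => quivDesc fun p => zeroCounit p ≫ Quiv.unitInc (eq_of_zero p)⟩

theorem quivInc_counit (a : X.vert) :
    quivInc (Path.const a) ≫ X.quivCounit.app a a = X.counit a ≫ Quiv.unitInc rfl := by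
  rw [← zeroCounit_const]
  exact quivInc_desc _ _

theorem quivInc_counit_assoc (a : X.vert) {Z : ModuleCat.{u} k} (z : _ ⟶ Z) :
    quivInc (Path.const a) ≫ X.quivCounit.app a a ≫ z =
      X.counit a ≫ Quiv.unitInc rfl ≫ z := by
  rw [reassoc_of% @quivInc_counit]

theorem comult_one_inv (X : PreCat k) {a b : X.vert} (p : Chain X.vert a b) :
    X.act (Chain.castIso (Nat.zero_add _) (Chain.one_mul_nat p)).inv ≫
      X.comult (Chain.one a) p ≫ X.counit a ▷ X.obj p = (λ_ (X.obj p)).inv := by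
  rw [← cancel_mono (λ_ (X.obj p)).hom]
  simp only [Category.assoc]
  rw [← comult_one, ← act_comp, Iso.inv_hom_id, act_id, Iso.inv_hom_id]

theorem one_comult_inv (X : PreCat k) {a b : X.vert} (p : Chain X.vert a b) :
    X.act (Chain.castIso (p := p.mul (Chain.one b)) (q := p) (Nat.add_zero _)
        (Chain.mul_one_nat p)).inv ≫
      X.comult p (Chain.one b) ≫ X.obj p ◁ X.counit b = (ρ_ (X.obj p)).inv := by
  rw [← cancel_mono (ρ_ (X.obj p)).hom]
  simp only [Category.assoc]
  rw [← one_comult, ← act_comp, Iso.inv_hom_id, act_id, Iso.inv_hom_id]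

theorem quivComult_left (n : FinInt) (h : (FinInt.sum FinInt.zero n).len = n.len) :
    (Quiv.leftUnit (X.quiv n)).inv =
      X.quivMap (FinInt.castHom h) ≫ X.quivComult FinInt.zero n ≫
        Quiv.tensMap X.quivCounit (𝟙 (X.quiv n)) :=
  Quiv.hom_ext fun a b => quiv_ext fun p => by
    have h1 := X.comult_one_inv ⟨n, p⟩
    simp only [Quiv.comp_app]
    rw [quivInc_map'_assoc (FinInt.castHom h) _ (Path.concat (Path.const a) p)
        (Chain.castIso (Nat.zero_add _) (Chain.one_mul_nat (⟨n, p⟩ : Chain X.vert a b))).inv rfl,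
      quivInc_comult_concat_assoc, Quiv.tensInc_map, tensorHom_comp_tensorHom_assoc,
      quivInc_counit, Quiv.id_app, Category.comp_id, Quiv.leftUnit_inv_app,
      ← whiskerRight_comp_tensorHom_assoc, MonoidalCategory.tensorHom_def'_assoc]
    rw [leftUnitor_inv_naturality_assoc, reassoc_of% h1]

theorem quivComult_right (n : FinInt) (h : (FinInt.sum n FinInt.zero).len = n.len) :
    (Quiv.rightUnit (X.quiv n)).inv =
      X.quivMap (FinInt.castHom h) ≫ X.quivComult n FinInt.zero ≫
        Quiv.tensMap (𝟙 (X.quiv n)) X.quivCounit :=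
  Quiv.hom_ext fun a b => quiv_ext fun p => by
    have h1 := X.one_comult_inv ⟨n, p⟩
    simp only [Quiv.comp_app]
    rw [quivInc_map'_assoc (FinInt.castHom h) _ (Path.concat p (Path.const b))
        (Chain.castIso (p := Chain.mul ⟨n, p⟩ (Chain.one b)) (q := ⟨n, p⟩) (Nat.add_zero _)
          (Chain.mul_one_nat (⟨n, p⟩ : Chain X.vert a b))).inv rfl,
      quivInc_comult_concat_assoc, Quiv.tensInc_map, tensorHom_comp_tensorHom_assoc,
      quivInc_counit, Quiv.id_app, Category.comp_id, Quiv.rightUnit_inv_app,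
      ← whiskerLeft_comp_tensorHom_assoc, MonoidalCategory.tensorHom_def_assoc]
    rw [rightUnitor_inv_naturality_assoc, reassoc_of% h1]

variable (X) in
/-- The colax monoidal structure on `𝔠'(X)`. -/
instance : (quivFunctor X).OplaxMonoidal where
  η := X.quivCounit
  δ m n := X.quivComult m.unop n.unop
  δ_natural_left {m _} f n :=
    (congrArg (fun g => X.quivComult m.unop n.unop ≫ Quiv.tensMap (X.quivMap f.unop) g)
      (X.quivFunctor.map_id n).symm).trans (quivComult_natural f.unop (𝟙 n.unop))
  δ_natural_right {n _} m f :=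
    (congrArg (fun g => X.quivComult m.unop n.unop ≫ Quiv.tensMap g (X.quivMap f.unop))
      (X.quivFunctor.map_id m).symm).trans (quivComult_natural (𝟙 m.unop) f.unop)
  oplax_associativity l m n := quivComult_assoc l.unop m.unop n.unop (Nat.add_assoc _ _ _).symm
  oplax_left_unitality n := quivComult_left n.unop (Nat.zero_add _)
  oplax_right_unitality n := quivComult_right n.unop (Nat.add_zero _)

instance : IsIso X.quivCounit := Quiv.isIso_of_app _ fun a b =>
  ⟨Quiv.unitDesc fun h => inv (X.counit a) ≫ quivInc (Path.const a) ≫ eqToHom (by rw [h]),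
    quiv_ext fun p => by
      obtain rfl := eq_of_zero p
      obtain rfl := eq_const p
      simp [quivInc_counit_assoc],
    Quiv.unit_ext fun h => by
      subst h
      simp [quivInc_counit]⟩

end Objects

/-- The templicial module `𝔠'(X)`. -/
def toTempMod (X : PreCat k) : TempMod k where
  vert := X.vert
  func := X.quivFunctor
  unital := inferInstanceAs (IsIso X.quivCounit)

/-- The components `𝔠'(X)ₙ(a, b) ⟶ 𝔠'(Y)ₙ(f a, f b)` of the morphism induced by a morphism of
enriched precategories. -/
def Hom.quivApp {X Y : PreCat k} (α : Hom X Y) (n : FinInt) (a b : X.vert) :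
    X.quiv n a b ⟶ Y.quiv n (α.f a) (α.f b) :=
  quivDesc fun p => α.app ⟨n, p⟩ ≫ quivInc (p.map α.f)

@[simp] theorem Hom.quivInc_app {X Y : PreCat k} (α : Hom X Y) {n : FinInt} {a b : X.vert}
    (p : Path X.vert n a b) :
    quivInc p ≫ α.quivApp n a b = α.app ⟨n, p⟩ ≫ quivInc (p.map α.f) := quivInc_desc _ p

@[simp] theorem Hom.quivInc_app_assoc {X Y : PreCat k} (α : Hom X Y) {n : FinInt} {a b : X.vert}
    (p : Path X.vert n a b) {Z : ModuleCat.{u} k} (z : _ ⟶ Z) :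
    quivInc p ≫ α.quivApp n a b ≫ z =
      α.app ⟨n, p⟩ ≫ quivInc (p.map α.f) ≫ z := by
  rw [reassoc_of% @Hom.quivInc_app]

theorem Hom.quivApp_natural {X Y : PreCat k} (α : Hom X Y) {m n : FinInt} (h : m ⟶ n)
    (a b : X.vert) :
    (X.quivMap h).app a b ≫ α.quivApp m a b =
      α.quivApp n a b ≫ (Y.quivMap h).app (α.f a) (α.f b) :=
  quiv_ext fun p => by
    rw [quivInc_map_assoc, quivInc_app, quivInc_app_assoc, quivInc_map,
      reassoc_of% (α.naturality (pullHom h p))]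
    rfl

theorem Hom.quivApp_comult {X Y : PreCat k} (α : Hom X Y) (m n : FinInt) (a b : X.vert) :
    (X.quivComult m n).app a b ≫ Quiv.tensAlong α.f (α.quivApp m) (α.quivApp n) a b =
      α.quivApp (FinInt.sum m n) a b ≫ (Y.quivComult m n).app (α.f a) (α.f b) :=
  quiv_ext fun p => by
    obtain ⟨c, q, r, rfl⟩ : ∃ (c : X.vert) (q : Path X.vert m a c) (r : Path X.vert n c b),
      p = Path.concat q r := ⟨_, p.take, p.drop, (Path.concat_take_drop p).symm⟩
    rw [quivInc_comult_concat_assoc, Quiv.tensInc_along, tensorHom_comp_tensorHom_assoc,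
      quivInc_app, quivInc_app, quivInc_app_assoc,
      quivInc_comult _ (q.map α.f) (r.map α.f) (Chain.mapMul α.f ⟨m, q⟩ ⟨n, r⟩)
        (FinInt.hom_ext fun i => (FinInt.nat_castHom rfl i).trans (FinInt.nat_id _ i).symm),
      ← tensorHom_comp_tensorHom_assoc, reassoc_of% (α.comult ⟨m, q⟩ ⟨n, r⟩)]

theorem Hom.quivApp_counit {X Y : PreCat k} (α : Hom X Y) (a b : X.vert) :
    X.quivCounit.app a b ≫ Quiv.unitAlong k α.f a b =
      α.quivApp FinInt.zero a b ≫ Y.quivCounit.app (α.f a) (α.f b) :=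
  quiv_ext fun p => by
    obtain rfl := eq_of_zero p
    obtain rfl := eq_const p
    have h : Chain.mapOne α.f a = 𝟙 (Chain.one (α.f a)) := Chain.hom_ext (FinInt.hom_ext fun i =>
      (FinInt.nat_castHom rfl i).trans (FinInt.nat_id _ i).symm)
    have h1 : X.counit a = α.app (Chain.one a) ≫ Y.counit (α.f a) := by
      refine (α.counit a).trans (congrArg (α.app (Chain.one a) ≫ ·) ?_)
      rw [h]
      exact (congrArg (· ≫ Y.counit (α.f a)) (Y.act_id (Chain.one (α.f a)))).trans
        (Category.id_comp _)
    have h2 : quivInc ((Path.const a).map α.f) ≫ Y.quivCounit.app (α.f a) (α.f a) =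
      Y.counit (α.f a) ≫ Quiv.unitInc rfl := quivInc_counit (X := Y) (α.f a)
    rw [quivInc_counit_assoc, Quiv.unitInc_along, quivInc_app_assoc, h2, h1]
    exact Category.assoc _ _ _

theorem Hom.quivInc_app_app {X Y Z : PreCat k} (α : Hom X Y) (β : Hom Y Z) {n : FinInt}
    {a b : X.vert} (p : Path X.vert n a b) :
    quivInc p ≫ α.quivApp n a b ≫ β.quivApp n (α.f a) (α.f b) =
      (α.app ⟨n, p⟩ ≫ β.app ⟨n, p.map α.f⟩) ≫ quivInc ((p.map α.f).map β.f) := by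
  rw [quivInc_app_assoc, quivInc_app, Category.assoc]

/-- The comparison functor `𝔠'` from enriched precategories to templicial modules. -/
def comparison (k : Type u) [CommRing k] : PreCat k ⥤ TempMod k where
  obj := toTempMod
  map α :=
    { f := α.f
      app := α.quivApp
      naturality := fun h a b => α.quivApp_natural h a b
      comult := fun m n a b => α.quivApp_comult m n a b
      counit := fun a b => α.quivApp_counit a b }
  map_id _ := TempMod.Hom.ext' rfl fun _ _ _ => (Category.comp_id _).trans
    (quiv_ext fun p => (Hom.quivInc_app _ p).trans ((Category.id_comp _).trans
      (Category.comp_id _).symm))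
  map_comp {X _ Z} α β := TempMod.Hom.ext' rfl fun _ _ _ => (Category.comp_id _).trans
    (quiv_ext fun p => (Hom.quivInc_app (X := X) (Y := Z) (α ≫ β) p).trans
      (Hom.quivInc_app_app α β p).symm)

end PreCat

/-! ### Edges and 2-simplices -/

/-- The element `x ⊗ y` of the summand `Q(a, c) ⊗ P(c, b)` of `(Q ⊗ P)(a, b)`. -/
def Quiv.tmul {k : Type u} [CommRing k] {S : Type u} {Q P : Quiv k S} {a c b : S}
    (x : Q a c) (y : P c b) : Quiv.tens Q P a b :=
  (Quiv.tensInc Q P a c b).hom (TensorProduct.tmul k x y)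

/-- The inner face map `[1] ⟶ [2]`, with values `0` and `2`. -/
def FinInt.innerFace : (⟨1⟩ : FinInt) ⟶ (⟨2⟩ : FinInt) where
  toFun := ![0, 2]
  monotone := by decide
  map_zero := rfl
  map_last := rfl

namespace TempMod

variable {k : Type u} [CommRing k] (X : TempMod k)

/-- The face map `d₁ : X₂(a, b) ⟶ X₁(a, b)`. -/
def d₁ (a b : X.vert) : X.quiv ⟨2⟩ a b ⟶ X.quiv ⟨1⟩ a b := X.act FinInt.innerFace a b

/-- The comultiplication `μ₁,₁ : X₂(a, b) ⟶ ⨁ c, X₁(a, c) ⊗ X₁(c, b)`. -/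
def μ₁₁ (a b : X.vert) : X.quiv ⟨2⟩ a b ⟶ Quiv.tens (X.quiv ⟨1⟩) (X.quiv ⟨1⟩) a b :=
  X.comult ⟨1⟩ ⟨1⟩ a b

/-- The edge `f ∈ X₁(a, b)` is a basis of the module `X₁(a, b)`. -/
def IsFreeGenerator {a b : X.vert} (f : X.quiv ⟨1⟩ a b) : Prop :=
  Function.Bijective fun r : k => r • f

end TempMod

end Templicial

end

noncomputable section

namespace Templicial

/-! ### Elements of tensor products of quivers -/

namespace Quiv

variable {k : Type u} [CommRing k] {S : Type u}

/-! In `𝔠'(X)` a 2-simplex is a sum of elements of modules `X(a, c, b)`, and the comultiplication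
sends each of these into the summand of the single inner vertex `c`. Morphisms of templicial modules
respect comultiplications, so they carry such a decomposition along. Hence every 2-simplex of a
templicial module in the essential image of `𝔠'` is a sum of 2-simplices each having its
comultiplication in one summand (`TempMod.mem_split_of_essImage`). It remains to find a templicial
module in which this fails.

The counterexample has simplices that remember heights but not vertices. Let `S` be a finite poset
with a strictly monotone height function. For `x ≤ y` take the free module on the order preserving
maps `s : [n] → ℕ` running from the height of `x` to the height of `y`, and take `0` if `x ≤ y`
fails. The comultiplication cuts `s` at `m` and sums over all vertices `c` with `x ≤ c ≤ y` whose
height is `s m`. Both sides of coassociativity become the same sum over pairs `c ≤ d` of prescribed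
heights. Strict monotonicity makes the module of 0-simplices vanish off the diagonal, which gives
the counit laws and strong unitality.

Two inner vertices `c`, `d` of equal height always occur together: the linear forms `innerCoeff`
that read off their contributions agree on every comultiplication (`Ranked.comult_innerCoeff_eq`). A
2-simplex whose comultiplication lies in a single summand misses `c` or `d`, so both of its
coefficients are zero, and sums of such simplices inherit this (`Ranked.split_le_ker`).

In the square `{0 < 1}²` the two middle vertices have height 1. The simplex `0 < 1 < 2` from bottom
to top has coefficient `1` at each of them, and `1 ≠ 0` in `k`. So it cannot be split, and the
templicial module is not in the essential image. -/

theorem tmul_sum {ι : Type*} (s : Finset ι) {Q P : Quiv k S} {a c b : S} (x : Q a c)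
    (y : ι → P c b) : tmul x (∑ i ∈ s, y i) = ∑ i ∈ s, tmul x (y i) := by
  simp only [tmul, TensorProduct.tmul_sum, map_sum]

theorem sum_tmul {ι : Type*} (s : Finset ι) {Q P : Quiv k S} {a c b : S} (x : ι → Q a c)
    (y : P c b) : tmul (∑ i ∈ s, x i) y = ∑ i ∈ s, tmul (x i) y := by
  simp only [tmul, TensorProduct.sum_tmul, map_sum]

@[simp] theorem zero_tmul {Q P : Quiv k S} {a c b : S} (y : P c b) :
    tmul (0 : Q a c) y = 0 := by
  simp only [tmul, TensorProduct.zero_tmul, map_zero]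

@[simp] theorem tmul_zero {Q P : Quiv k S} {a c b : S} (x : Q a c) :
    tmul x (0 : P c b) = 0 := by
  simp only [tmul, TensorProduct.tmul_zero, map_zero]

@[simp] theorem tensDesc_tmul {Q P : Quiv k S} {a b : S} {M : ModuleCat.{u} k}
    (f : ∀ c, Q a c ⊗ P c b ⟶ M) {c : S} (x : Q a c) (y : P c b) :
    (tensDesc f).hom (tmul x y) = (f c).hom (TensorProduct.tmul k x y) :=
  LinearMap.congr_fun (congrArg ModuleCat.Hom.hom (tensInc_desc f c)) (TensorProduct.tmul k x y)

@[simp] theorem tensMap_tmul {Q Q' P P' : Quiv k S} (f : Q ⟶ Q') (g : P ⟶ P') {a c b : S}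
    (x : Q a c) (y : P c b) :
    ((tensMap f g).app a b).hom (tmul x y) = tmul ((f.app a c).hom x) ((g.app c b).hom y) :=
  tensDesc_tmul _ x y

@[simp] theorem assoc_tmul {Q P R : Quiv k S} {a d c b : S} (x : Q a d) (y : P d c) (z : R c b) :
    ((assoc Q P R).hom.app a b).hom (tmul (Q := tens Q P) (tmul x y) z) =
      tmul (P := tens P R) x (tmul y z) :=
  LinearMap.congr_fun (congrArg ModuleCat.Hom.hom (inc_assoc_hom Q P R a b c d))
    (TensorProduct.tmul k (TensorProduct.tmul k x y) z)

theorem leftUnit_inv_apply {Q : Quiv k S} {a b : S} (x : Q a b) :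
    ((leftUnit Q).inv.app a b).hom x =
      tmul (Q := unit k S) ((unitInc (k := k) (rfl : a = a)).hom (1 : k)) x := rfl

theorem rightUnit_inv_apply {Q : Quiv k S} {a b : S} (x : Q a b) :
    ((rightUnit Q).inv.app a b).hom x =
      tmul (P := unit k S) x ((unitInc (k := k) (rfl : b = b)).hom (1 : k)) := rfl

end Quiv

/-- The values of a morphism of finite intervals as an order preserving map of natural numbers. -/
def FinInt.Hom.natHom {m n : FinInt} (f : m ⟶ n) : ℕ →o ℕ where
  toFun := Hom.nat f
  monotone' i j h := by
    by_cases hj : j ≤ m.len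
    · have := f.monotone (show (⟨i, by omega⟩ : Fin (m.len + 1)) ≤ ⟨j, by omega⟩ from h)
      rw [Fin.le_def, Hom.nat_val, Hom.nat_val] at this
      exact this
    -- Past the end of `[m]` the extension is the translation `m + l ↦ n + l`, which stays above all
    -- values on `[m]`, these being at most `n`.
    · obtain ⟨l, rfl⟩ := Nat.exists_eq_add_of_le (Nat.le_of_not_le hj)
      by_cases hi : i ≤ m.len
      · have := Hom.nat_le f hi
        rw [Hom.nat_add]
        omega
      · obtain ⟨l', rfl⟩ := Nat.exists_eq_add_of_le (Nat.le_of_not_le hi)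
        rw [Hom.nat_add, Hom.nat_add]
        omega

@[simp] theorem FinInt.Hom.natHom_apply {m n : FinInt} (f : m ⟶ n) (i : ℕ) :
    Hom.natHom f i = Hom.nat f i := rfl

/-! ### The templicial module of a ranked poset -/

namespace Ranked

variable {S : Type u} [PartialOrder S] (ht : S → ℕ)

/-- The order preserving maps `[n] → ℕ` from the height of `x` to the height of `y`, for
`x ≤ y`. -/
def Basis (n : FinInt) (x y : S) : Type :=
  {s : Fin (n.len + 1) →o ℕ // x ≤ y ∧ s 0 = ht x ∧ s (Fin.last n.len) = ht y}

variable (k : Type u) [CommRing k]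

/-- The quiver of free modules on the order preserving maps `[n] → ℕ` with suitable endpoints. -/
def quiv (n : FinInt) : Quiv k S := ⟨fun x y => ModuleCat.of k (Basis ht n x y →₀ k)⟩

variable {ht k} {m n l : FinInt} {x y : S} {M : ModuleCat.{u} k}

/-- The extension of a basis element to an order preserving map on the natural numbers. -/
def Basis.extend (s : Basis ht n x y) : ℕ →o ℕ where
  toFun i := s.1 ⟨min i n.len, by omega⟩
  monotone' i j h := s.1.monotone (by
    rw [Fin.le_def]
    exact min_le_min_right _ h)

theorem Basis.extend_apply (s : Basis ht n x y) (i : ℕ) :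
    s.extend i = s.1 ⟨min i n.len, by omega⟩ := rfl

theorem Basis.extend_zero (s : Basis ht n x y) : s.extend 0 = ht x := by
  rw [← s.2.2.1, extend_apply]
  congr 1

theorem Basis.extend_last (s : Basis ht n x y) : s.extend n.len = ht y := by
  rw [← s.2.2.2, extend_apply]
  congr 1
  simp [Fin.ext_iff]

/-- The restriction to `[n]` of an order preserving map on the natural numbers. -/
def Basis.restrict (s : ℕ →o ℕ) (h : x ≤ y ∧ s 0 = ht x ∧ s n.len = ht y) : Basis ht n x y :=
  ⟨⟨fun i => s i.val, fun _ _ hij => s.monotone hij⟩, h⟩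

theorem Basis.restrict_congr {s t : ℕ →o ℕ} (h : ∀ i ≤ n.len, s i = t i)
    (hs : x ≤ y ∧ s 0 = ht x ∧ s n.len = ht y) (ht' : x ≤ y ∧ t 0 = ht x ∧ t n.len = ht y) :
    (restrict s hs : Basis ht n x y) = restrict t ht' :=
  Subtype.ext (OrderHom.ext _ _ (funext fun i => h i.val (Nat.le_of_lt_succ i.2)))

theorem Basis.restrict_extend (s : Basis ht n x y) :
    restrict s.extend ⟨s.2.1, s.extend_zero, s.extend_last⟩ = s :=
  Subtype.ext (OrderHom.ext _ _ (funext fun i => congrArg s.1 (Fin.ext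
    (Nat.min_eq_left (Nat.le_of_lt_succ i.2)))))

open Classical in
variable (ht k n x y) in
/-- The basis element given by the restriction of `s` to `[n]`, or `0` if the endpoints of this
restriction are not those required. -/
def elt (s : ℕ →o ℕ) : quiv ht k n x y :=
  if h : x ≤ y ∧ s 0 = ht x ∧ s n.len = ht y then Finsupp.single (Basis.restrict s h) (1 : k)
  else (0 : Basis ht n x y →₀ k)

theorem elt_eq_single {s : ℕ →o ℕ} (h : x ≤ y ∧ s 0 = ht x ∧ s n.len = ht y) :
    elt ht k n x y s = Finsupp.single (Basis.restrict s h) (1 : k) := dif_pos h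

theorem elt_eq_zero {s : ℕ →o ℕ} (h : ¬ (x ≤ y ∧ s 0 = ht x ∧ s n.len = ht y)) :
    elt ht k n x y s = 0 := dif_neg h

/-- Both the endpoint test and the restriction see only the values on `[n]`. Basis elements can
therefore be indexed by maps on all of `ℕ`: pulling back is composition, cutting is a shift, and no
casts between the finite types of `[m + n]` and its parts arise. -/
theorem elt_congr {s t : ℕ →o ℕ} (h : ∀ i ≤ n.len, s i = t i) :
    elt ht k n x y s = elt ht k n x y t := by
  have h0 := h 0 (Nat.zero_le _)
  have hn := h n.len le_rfl
  by_cases hs : x ≤ y ∧ s 0 = ht x ∧ s n.len = ht y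
  · have ht' : x ≤ y ∧ t 0 = ht x ∧ t n.len = ht y := by rwa [← h0, ← hn]
    rw [elt_eq_single hs, elt_eq_single ht', Basis.restrict_congr h hs ht']
  · rw [elt_eq_zero hs, elt_eq_zero (by rwa [← h0, ← hn])]

theorem elt_extend (s : Basis ht n x y) :
    elt ht k n x y s.extend = Finsupp.single s (1 : k) := by
  rw [elt_eq_single ⟨s.2.1, s.extend_zero, s.extend_last⟩, Basis.restrict_extend]

/-- Every basis element is `elt` of its own extension. Testing on all `s`, including those with
`elt` equal to `0`, is harmless because the formulas for the structure maps hold for them as well.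
-/
theorem hom_ext {f g : quiv ht k n x y ⟶ M}
    (h : ∀ s, f.hom (elt ht k n x y s) = g.hom (elt ht k n x y s)) : f = g := by
  apply ModuleCat.hom_ext
  refine Finsupp.lhom_ext' fun s => LinearMap.ext_ring ?_
  have := h s.extend
  rw [elt_extend] at this
  exact this

/-- The morphism out of `quiv ht k n x y` with given values on the basis. -/
def lift (F : (ℕ →o ℕ) → M) : quiv ht k n x y ⟶ M :=
  ModuleCat.ofHom (Finsupp.linearCombination k fun s : Basis ht n x y => F s.extend)

/-- `lift` only uses the values of `F` on extensions of basis elements. The formula holds for a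
general `s` once `F` depends only on the restriction to `[n]` and vanishes where `elt` takes its
default value `0`. -/
theorem lift_elt (F : (ℕ →o ℕ) → M) (h : ∀ s t : ℕ →o ℕ, (∀ i ≤ n.len, s i = t i) → F s = F t)
    (s : ℕ →o ℕ) (h0 : ¬ (x ≤ y ∧ s 0 = ht x ∧ s n.len = ht y) → F s = 0) :
    (lift F : quiv ht k n x y ⟶ M).hom (elt ht k n x y s) = F s := by
  by_cases hs : x ≤ y ∧ s 0 = ht x ∧ s n.len = ht y
  · rw [elt_eq_single hs]
    refine (Finsupp.linearCombination_single k _ _).trans ((one_smul k _).trans (h _ _ ?_))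
    intro i hi
    exact congrArg s (Nat.min_eq_left hi)
  · rw [elt_eq_zero hs, map_zero, h0 hs]

/-- The map induced by a morphism of finite intervals. -/
def act (h : m ⟶ n) : quiv ht k n ⟶ (quiv ht k m : Quiv k S) :=
  ⟨fun x y => lift fun s => elt ht k m x y (s.comp (FinInt.Hom.natHom h))⟩

@[simp] theorem act_elt (h : m ⟶ n) (s : ℕ →o ℕ) :
    ((act h).app x y).hom (elt ht k n x y s) = elt ht k m x y (s.comp (FinInt.Hom.natHom h)) := by
  refine lift_elt (fun s => elt ht k m x y (s.comp (FinInt.Hom.natHom h)))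
    (fun s t hst => elt_congr fun i hi => hst _ (FinInt.Hom.nat_le h hi)) s
    fun hs => elt_eq_zero ?_
  -- A morphism of finite intervals preserves endpoints, so `s` and its composite pass or fail the
  -- endpoint test together.
  simpa using hs

variable (ht k) in
/-- The functor of free modules on order preserving maps `[n] → ℕ` with suitable endpoints. -/
def functor : FinIntᵒᵖ ⥤ Quiv k S where
  obj n := quiv ht k n.unop
  map h := act h.unop
  map_id n := Quiv.hom_ext fun x y => hom_ext fun s => by
    refine (act_elt _ _).trans (elt_congr fun i _ => ?_)
    simp [FinInt.nat_id]
  map_comp f g := Quiv.hom_ext fun x y => hom_ext fun s => by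
    rw [Quiv.comp_app, ModuleCat.hom_comp, LinearMap.comp_apply, act_elt, act_elt, act_elt]
    exact elt_congr fun i _ => by simp [FinInt.nat_comp]

/-- The shifted map `i ↦ s (m + i)`. -/
def shift (m : FinInt) (s : ℕ →o ℕ) : ℕ →o ℕ := s.comp ⟨(m.len + ·), fun _ _ h => by
  simpa using h⟩

@[simp] theorem shift_apply (m : FinInt) (s : ℕ →o ℕ) (i : ℕ) : shift m s i = s (m.len + i) := rfl

/-- The counit, which sends the basis element of `quiv ht k 0 x x` to `1`. -/
def counit : quiv ht k FinInt.zero ⟶ Quiv.unit k S :=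
  ⟨fun x y => lift fun s => open Classical in
    if h : x = y ∧ s 0 = ht x then (Quiv.unitInc h.1).hom (1 : k) else 0⟩

/-- The diagonal suffices: off it the 0-simplices vanish as soon as the height function is strictly
monotone. -/
theorem counit_elt (x : S) (s : ℕ →o ℕ) :
    (counit.app x x).hom (elt ht k FinInt.zero x x s) = open Classical in
      if s 0 = ht x then (Quiv.unitInc (k := k) (rfl : x = x)).hom (1 : k) else 0 := by
  refine (lift_elt _ (fun s t hst => ?_) s fun hs => ?_).trans ?_
  · simp only [hst 0 (Nat.zero_le _)]
  · refine dif_neg fun h => hs ⟨le_rfl, h.2, h.2⟩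
  · by_cases h : s 0 = ht x
    · rw [if_pos h, dif_pos ⟨rfl, h⟩]
    · rw [if_neg h, dif_neg fun h' => h h'.2]

/-! ### Comultiplication and coassociativity -/

variable [Fintype S]

/-- The comultiplication, which sends `s` to the sum of all `s|[0, m] ⊗ s|[m, m + n]` over the
intermediate elements `c` of height `s m`. -/
def comult (m n : FinInt) :
    quiv ht k (FinInt.sum m n) ⟶ (Quiv.tens (quiv ht k m) (quiv ht k n) : Quiv k S) :=
  ⟨fun x y => lift fun s => ∑ c, Quiv.tmul (elt ht k m x c s) (elt ht k n c y (shift m s))⟩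

@[simp] theorem comult_elt (s : ℕ →o ℕ) :
    ((comult m n).app x y).hom (elt ht k (FinInt.sum m n) x y s) =
      ∑ c, Quiv.tmul (elt ht k m x c s) (elt ht k n c y (shift m s)) := by
  refine lift_elt
    (fun s => ∑ c, Quiv.tmul (elt ht k m x c s) (elt ht k n c y (shift m s)))
    (fun s t hst => Finset.sum_congr rfl fun c _ => ?_) s fun hs =>
    Finset.sum_eq_zero fun c _ => ?_
  · rw [elt_congr (s := s) (t := t) fun i hi => hst _ (by simp; omega),
      elt_congr (s := shift m s) (t := shift m t) fun i hi =>
        hst _ (Nat.add_le_add_left hi m.len)]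
  -- If both factors of the summand at `c` were nonzero, then `x ≤ c ≤ y` and `s` would have the
  -- correct endpoints. This default value `0` is why the sum can run over all of `S` without side
  -- conditions.
  · by_cases h : x ≤ c ∧ s 0 = ht x ∧ s m.len = ht c
    · rw [elt_eq_zero (n := n), Quiv.tmul_zero]
      exact fun h' => hs ⟨h.1.trans h'.1, h.2.1, h'.2.2⟩
    · rw [elt_eq_zero h, Quiv.zero_tmul]

/-- The glued map sends the cutting point `m'` to `m`, so the height required of the inner vertex
does not change and the two sums agree term by term. -/
theorem comult_natural {m' n' : FinInt} (f : m' ⟶ m) (g : n' ⟶ n) :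
    comult m n ≫ Quiv.tensMap (act f) (act g) =
      act (FinInt.sumMap f g) ≫ (comult m' n' : quiv ht k (FinInt.sum m' n') ⟶ _) :=
  Quiv.hom_ext fun x y => hom_ext fun s => by
    simp only [Quiv.comp_app, ModuleCat.hom_comp, LinearMap.comp_apply, comult_elt, map_sum,
      Quiv.tensMap_tmul, act_elt]
    refine Finset.sum_congr rfl fun c _ => congrArg₂ _ (elt_congr fun i hi => ?_)
      (elt_congr fun i hi => ?_)
    · simp [FinInt.nat_sumMap_left f g hi]
    · simp [FinInt.nat_sumMap_right f g i]

/-- Both sides expand to the double sum over inner vertices `c`, `d` of the three pieces of `s`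
between `0`, `l`, `l + m` and `l + m + n`. Only the order of summation differs. -/
theorem comult_assoc (l m n : FinInt)
    (h : (FinInt.sum l (FinInt.sum m n)).len = (FinInt.sum (FinInt.sum l m) n).len) :
    comult (FinInt.sum l m) n ≫ Quiv.tensMap (comult l m) (𝟙 (quiv ht k n)) ≫
        (Quiv.assoc (quiv ht k l) (quiv ht k m) (quiv ht k n)).hom =
      act (FinInt.castHom h) ≫ comult l (FinInt.sum m n) ≫
        Quiv.tensMap (𝟙 (quiv ht k l : Quiv k S)) (comult m n) :=
  Quiv.hom_ext fun x y => hom_ext fun s => by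
    simp only [Quiv.comp_app, ModuleCat.hom_comp, LinearMap.comp_apply, comult_elt, map_sum,
      Quiv.tensMap_tmul, act_elt, Quiv.sum_tmul, Quiv.tmul_sum, Quiv.assoc_tmul, Quiv.id_app,
      ModuleCat.hom_id, LinearMap.id_apply]
    rw [Finset.sum_comm]
    refine Finset.sum_congr rfl fun c _ => Finset.sum_congr rfl fun d _ =>
      congrArg₂ _ (elt_congr fun i hi => ?_) (congrArg₂ _ (elt_congr fun i hi => ?_)
        (elt_congr fun i hi => ?_))
    all_goals simp [FinInt.nat_castHom, Nat.add_assoc]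

end Ranked

/-! ### Strict monotonicity of heights: counit laws and strong unitality -/

namespace Ranked

variable {S : Type u} [PartialOrder S] {ht : S → ℕ} {k : Type u} [CommRing k] {m n : FinInt}
  {x y : S}

/-- A map on `[0]` has one value, which would have to be the height of both `x` and `y`, while `x <
y` forces these to differ. All uses of strict monotonicity go through this fact. -/
theorem elt_zero_of_ne (hh : StrictMono ht) (h : x ≠ y) (s : ℕ →o ℕ) :
    elt ht k FinInt.zero x y s = 0 :=
  elt_eq_zero fun hs => (hh (lt_of_le_of_ne hs.1 h)).ne (hs.2.1.symm.trans hs.2.2)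

/-- The morphism `k ⟶ M` with value `e` at `1`. -/
def ofElement {M : ModuleCat.{u} k} (e : M) : 𝟙_ (ModuleCat.{u} k) ⟶ M :=
  ModuleCat.ofHom (LinearMap.toSpanSingleton k M e)

theorem ofElement_one {M : ModuleCat.{u} k} (e : M) : (ofElement e).hom (1 : k) = e :=
  one_smul k e

variable (ht k x y) in
/-- The inverse of the counit. -/
def counitInv : Quiv.unit k S x y ⟶ quiv ht k FinInt.zero x y :=
  Quiv.unitDesc fun _ => ofElement (elt ht k FinInt.zero x y (OrderHom.const ℕ (ht x)))

theorem counitInv_unitInc (h : x = y) :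
    (counitInv ht k x y).hom ((Quiv.unitInc h).hom (1 : k)) =
      elt ht k FinInt.zero x y (OrderHom.const ℕ (ht x)) :=
  (LinearMap.congr_fun (congrArg ModuleCat.Hom.hom (Quiv.unitInc_desc
    (fun _ => ofElement (elt ht k FinInt.zero x y (OrderHom.const ℕ (ht x)))) h)) (1 : k)).trans
      (ofElement_one _)

/-- Off the diagonal both modules are zero. On the diagonal the only basis element is the constant
map at the height of `x`, which corresponds to `1`. -/
theorem isIso_counit (hh : StrictMono ht) : IsIso (counit : quiv ht k FinInt.zero ⟶ _) :=
  Quiv.isIso_of_app _ fun x y =>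
    ⟨counitInv ht k x y,
      hom_ext fun s => by
        by_cases hxy : x = y
        · subst hxy
          rw [ModuleCat.hom_comp, LinearMap.comp_apply, counit_elt]
          split_ifs with hs
          · refine (counitInv_unitInc rfl).trans (elt_congr fun i hi => ?_)
            obtain rfl : i = 0 := Nat.le_zero.mp hi
            exact hs.symm
          · rw [elt_eq_zero fun h => hs h.2.1, map_zero, map_zero]
        · rw [elt_zero_of_ne hh hxy, map_zero, map_zero],
      Quiv.unit_ext fun h => by
        subst h
        apply ModuleCat.hom_ext
        refine LinearMap.ext_ring ?_
        refine (congrArg (counit.app x x).hom (counitInv_unitInc rfl)).trans ?_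
        rw [counit_elt]
        exact if_pos rfl⟩

variable [Fintype S]

/-- Cutting at `0` leaves a 0-simplex from `x` to `c`, which vanishes unless `c = x`. The surviving
term is the unit at `x` tensored with `s`. -/
theorem comult_left (hh : StrictMono ht) (n : FinInt)
    (h : (FinInt.sum FinInt.zero n).len = n.len) :
    (Quiv.leftUnit (quiv ht k n)).inv =
      act (FinInt.castHom h) ≫ comult FinInt.zero n ≫
        Quiv.tensMap counit (𝟙 (quiv ht k n : Quiv k S)) :=
  Quiv.hom_ext fun x y => hom_ext fun s => by
    simp only [Quiv.comp_app, ModuleCat.hom_comp, LinearMap.comp_apply, act_elt, comult_elt,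
      map_sum, Quiv.tensMap_tmul, Quiv.id_app, ModuleCat.hom_id, LinearMap.id_apply]
    rw [Finset.sum_eq_single x, counit_elt, Quiv.leftUnit_inv_apply]
    · split_ifs with hs
      · refine congrArg _ (elt_congr fun i _ => ?_)
        simp [FinInt.nat_castHom]
      -- Here `s` does not start at the height of `x`, so the counit and the element for `s` itself
      -- are both zero.
      · rw [elt_eq_zero, Quiv.tmul_zero, Quiv.zero_tmul]
        exact fun hs' => hs ((congrArg s (FinInt.Hom.nat_zero _)).trans hs'.2.1)
    · intro c _ hc
      rw [elt_zero_of_ne hh hc.symm, map_zero, Quiv.zero_tmul]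
    · exact fun hx => (hx (Finset.mem_univ x)).elim

theorem comult_right (hh : StrictMono ht) (n : FinInt)
    (h : (FinInt.sum n FinInt.zero).len = n.len) :
    (Quiv.rightUnit (quiv ht k n)).inv =
      act (FinInt.castHom h) ≫ comult n FinInt.zero ≫
        Quiv.tensMap (𝟙 (quiv ht k n : Quiv k S)) counit :=
  Quiv.hom_ext fun x y => hom_ext fun s => by
    simp only [Quiv.comp_app, ModuleCat.hom_comp, LinearMap.comp_apply, act_elt, comult_elt,
      map_sum, Quiv.tensMap_tmul, Quiv.id_app, ModuleCat.hom_id, LinearMap.id_apply]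
    rw [Finset.sum_eq_single y, counit_elt, Quiv.rightUnit_inv_apply]
    · have hn : shift n (s.comp (FinInt.Hom.natHom (FinInt.castHom h))) 0 = s n.len := by
        simp [FinInt.nat_castHom]
      rw [hn]
      split_ifs with hs
      · refine congrArg (fun e => Quiv.tmul e _) (elt_congr fun i _ => ?_)
        simp [FinInt.nat_castHom]
      · rw [elt_eq_zero fun hs' => hs hs'.2.2, Quiv.tmul_zero, Quiv.zero_tmul]
    · intro c _ hc
      rw [elt_zero_of_ne hh hc, map_zero, Quiv.tmul_zero]
    · exact fun hy => (hy (Finset.mem_univ y)).elim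

/-- The colax monoidal structure on `functor ht k`. -/
@[reducible] def oplaxMonoidal (hh : StrictMono ht) : (functor ht k).OplaxMonoidal where
  η := counit
  δ m n := comult m.unop n.unop
  δ_natural_left {m _} f n :=
    (congrArg (fun g => comult m.unop n.unop ≫ Quiv.tensMap (act f.unop) g)
      ((functor ht k).map_id n).symm).trans (comult_natural f.unop (𝟙 n.unop))
  δ_natural_right {n _} m f :=
    (congrArg (fun g => comult m.unop n.unop ≫ Quiv.tensMap g (act f.unop))
      ((functor ht k).map_id m).symm).trans (comult_natural (𝟙 m.unop) f.unop)
  oplax_associativity l m n := comult_assoc l.unop m.unop n.unop (Nat.add_assoc _ _ _).symm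
  oplax_left_unitality n := comult_left hh n.unop (Nat.zero_add _)
  oplax_right_unitality n := comult_right hh n.unop (Nat.add_zero _)

variable (k) in
/-- The templicial module of a finite poset with a strictly monotone height function. -/
def tempMod (hh : StrictMono ht) : TempMod k where
  vert := S
  func := functor ht k
  colax := oplaxMonoidal hh
  unital := isIso_counit hh

end Ranked

/-! ### Splitting over the inner vertex -/

/-- Composing with the quotient map by `P` turns membership into the vanishing of a morphism, which
can be tested on the summands. -/
theorem dsum_apply_mem {k : Type u} [CommRing k] {ι : Type u}
    {M : ι → ModuleCat.{u} k} {N : ModuleCat.{u} k} (f : dsum M ⟶ N) (P : Submodule k N)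
    (h : ∀ i z, f.hom ((inc M i).hom z) ∈ P) (w : dsum M) : f.hom w ∈ P := by
  have h1 : f ≫ ModuleCat.ofHom P.mkQ = 0 := dsum_ext fun i => by
    rw [Limits.comp_zero]
    exact ModuleCat.hom_ext (LinearMap.ext fun z => (Submodule.Quotient.mk_eq_zero P).mpr (h i z))
  exact (Submodule.Quotient.mk_eq_zero P).mp
    (LinearMap.congr_fun (congrArg ModuleCat.Hom.hom h1) w)

namespace TempMod

variable {k : Type u} [CommRing k]

/-- The submodule generated by the 2-simplices whose comultiplication lies in the summand belonging
to a single inner vertex. -/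
def split (Y : TempMod k) (a b : Y.vert) : Submodule k (Y.quiv ⟨2⟩ a b) :=
  ⨆ x, (LinearMap.range (Quiv.tensInc (Y.quiv ⟨1⟩) (Y.quiv ⟨1⟩) a x b).hom).comap (Y.μ₁₁ a b).hom

variable {Y : TempMod k} {a b : Y.vert}

theorem mem_split {w : Y.quiv ⟨2⟩ a b} (x : Y.vert)
    (h : (Y.μ₁₁ a b).hom w ∈ LinearMap.range
      (Quiv.tensInc (Y.quiv ⟨1⟩) (Y.quiv ⟨1⟩) a x b).hom) : w ∈ Y.split a b :=
  Submodule.mem_iSup_of_mem x h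

/-- Compatibility of `α` with comultiplications makes the composite factor through one coprojection,
that of the image of the middle vertex `c`. The first factor on the right is irrelevant beyond its
existence. -/
theorem comparison_comp_μ₁₁ {X : PreCat k} (α : (PreCat.comparison k).obj X ⟶ Y)
    {a b c : X.vert} (q : Path X.vert ⟨1⟩ a c) (r : Path X.vert ⟨1⟩ c b) :
    PreCat.quivInc (Path.concat q r) ≫ Hom.app α ⟨2⟩ a b ≫ Y.μ₁₁ (Hom.f α a) (Hom.f α b) =
      (X.comult ⟨⟨1⟩, q⟩ ⟨⟨1⟩, r⟩ ≫ (PreCat.quivInc q ⊗ₘ PreCat.quivInc r) ≫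
        (Hom.app α ⟨1⟩ a c ⊗ₘ Hom.app α ⟨1⟩ c b)) ≫
        Quiv.tensInc (Y.quiv ⟨1⟩) (Y.quiv ⟨1⟩) (Hom.f α a) (Hom.f α c) (Hom.f α b) := by
  have h1 : (X.quivComult ⟨1⟩ ⟨1⟩).app a b ≫
      Quiv.tensAlong (Hom.f α) (Hom.app α ⟨1⟩) (Hom.app α ⟨1⟩) a b =
        Hom.app α ⟨2⟩ a b ≫ Y.μ₁₁ (Hom.f α a) (Hom.f α b) := Hom.comult α ⟨1⟩ ⟨1⟩ a b
  have h2 := PreCat.quivInc_comult_concat_assoc q r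
    (Quiv.tensAlong (Hom.f α) (Hom.app α ⟨1⟩) (Hom.app α ⟨1⟩) a b)
  refine (congrArg (PreCat.quivInc (Path.concat q r) ≫ ·) h1.symm).trans (h2.trans ?_)
  simp only [Category.assoc]
  exact congrArg (fun g => X.comult ⟨⟨1⟩, q⟩ ⟨⟨1⟩, r⟩ ≫
    (PreCat.quivInc q ⊗ₘ PreCat.quivInc r) ≫ g) (Quiv.tensInc_along _ _ _ a c b)

/-- This needs no invertibility of `α`: it is enough to treat an element of one module `X(a, c, b)`,
where the factorization above applies. -/
theorem app_mem_split_of_comparison {X : PreCat k} (α : (PreCat.comparison k).obj X ⟶ Y)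
    {a b : X.vert} (w : X.quiv ⟨2⟩ a b) :
    (Hom.app α ⟨2⟩ a b).hom w ∈ Y.split (Hom.f α a) (Hom.f α b) := by
  refine dsum_apply_mem (Hom.app α ⟨2⟩ a b) _ (fun p z => ?_) w
  obtain ⟨c, q, r, rfl⟩ : ∃ (c : X.vert) (q : Path X.vert ⟨1⟩ a c) (r : Path X.vert ⟨1⟩ c b),
    p = Path.concat q r :=
      ⟨_, Path.take (m := ⟨1⟩) (n := ⟨1⟩) p, Path.drop (m := ⟨1⟩) (n := ⟨1⟩) p,
        (Path.concat_take_drop (m := ⟨1⟩) (n := ⟨1⟩) p).symm⟩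
  exact mem_split (Hom.f α c)
    ⟨_, (LinearMap.congr_fun (congrArg ModuleCat.Hom.hom (comparison_comp_μ₁₁ α q r)) z).symm⟩

/-- In a templicial module in the essential image of the comparison functor, every 2-simplex can be
split over its inner vertices. -/
theorem mem_split_of_essImage (h : (PreCat.comparison k).essImage Y) (w : Y.quiv ⟨2⟩ a b) :
    w ∈ Y.split a b := by
  obtain ⟨X, ⟨e⟩⟩ := h
  -- The vertices are kept as images under the composite `e.inv ≫ e.hom`, so that rewriting the
  -- composite to the identity corrects them and the simplex at once, without transport along
  -- equalities of vertices.
  have h1 : (Hom.app (e.inv ≫ e.hom) ⟨2⟩ a b).hom w ∈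
      Y.split (Hom.f (e.inv ≫ e.hom) a) (Hom.f (e.inv ≫ e.hom) b) :=
    app_mem_split_of_comparison e.hom ((Hom.app e.inv ⟨2⟩ a b).hom w)
  rw [e.inv_hom_id] at h1
  exact h1

end TempMod

/-! ### Edges of the ranked templicial module, and coefficients at inner vertices -/

namespace Ranked

variable {S : Type u} [PartialOrder S] {ht : S → ℕ} {k : Type u} [CommRing k] {m n : FinInt}
  {x y : S}

instance : Subsingleton (Basis ht ⟨1⟩ x y) where
  allEq s t := Subtype.ext (OrderHom.ext _ _ (funext fun i =>
    match i with
    | 0 => s.2.2.1.trans t.2.2.1.symm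
    | 1 => s.2.2.2.trans t.2.2.2.symm))

/-- A map on `[1]` is determined by its two prescribed endpoints, so the module of edges is free on
a single basis element. -/
theorem bijective_smul_elt_one {s : ℕ →o ℕ} (h : x ≤ y ∧ s 0 = ht x ∧ s 1 = ht y) :
    Function.Bijective fun r : k => r • elt ht k ⟨1⟩ x y s := by
  have h1 : ∀ r : k, r • elt ht k ⟨1⟩ x y s = Finsupp.single (Basis.restrict s h) r := fun r => by
    rw [elt_eq_single h]
    exact Finsupp.smul_single_one _ r
  refine ⟨fun r r' hr => Finsupp.single_injective (Basis.restrict s h)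
    ((h1 r).symm.trans (hr.trans (h1 r'))), fun z => ?_⟩
  refine ⟨(show Basis ht ⟨1⟩ x y →₀ k from z) (Basis.restrict s h), (h1 _).trans ?_⟩
  refine Finsupp.ext fun t => ?_
  obtain rfl := Subsingleton.elim (Basis.restrict s h) t
  exact Finsupp.single_eq_same

theorem subsingleton_quiv (h : ¬ x ≤ y) : Subsingleton (quiv ht k n x y) := by
  have : IsEmpty (Basis ht n x y) := ⟨fun s => h s.2.1⟩
  exact inferInstanceAs (Subsingleton (Basis ht n x y →₀ k))

open Classical in
variable (ht k n x y) in
/-- The value `1` if the restriction of `s` to `[n]` has the required endpoints, and `0`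
otherwise. -/
def indicator (s : ℕ →o ℕ) : k := if x ≤ y ∧ s 0 = ht x ∧ s n.len = ht y then 1 else 0

variable (ht k n x y) in
/-- The linear form with value `1` on all basis elements. -/
def augmentation : quiv ht k n x y ⟶ 𝟙_ (ModuleCat.{u} k) :=
  lift (M := 𝟙_ (ModuleCat.{u} k)) (indicator ht k n x y)

theorem augmentation_elt (s : ℕ →o ℕ) :
    (augmentation ht k n x y).hom (elt ht k n x y s) = indicator ht k n x y s := by
  refine lift_elt (M := 𝟙_ (ModuleCat.{u} k)) (indicator ht k n x y) (fun s t hst => ?_) s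
    fun h => if_neg h
  rw [indicator, indicator, hst 0 (Nat.zero_le _), hst n.len le_rfl]

open Classical in
variable (ht k m n x y) in
/-- The linear form with value `1` on the tensor products of basis elements in the summand of the
inner vertex `c`, and `0` on the other summands. -/
def innerCoeff (c : S) : Quiv.tens (quiv ht k m) (quiv ht k n) x y ⟶ 𝟙_ (ModuleCat.{u} k) :=
  Quiv.tensDesc fun d => if d = c then
    (augmentation ht k m x d ⊗ₘ augmentation ht k n d y) ≫ (λ_ _).hom else 0

theorem innerCoeff_tmul_self (c : S) (z : quiv ht k m x c) (z' : quiv ht k n c y) :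
    (innerCoeff ht k m n x y c).hom (Quiv.tmul z z') =
      (show k from (augmentation ht k m x c).hom z) *
        (show k from (augmentation ht k n c y).hom z') := by
  refine (Quiv.tensDesc_tmul _ z z').trans ?_
  rw [if_pos rfl]
  rfl

theorem tensInc_innerCoeff_of_ne {c d : S} (h : d ≠ c) :
    Quiv.tensInc (quiv ht k m) (quiv ht k n) x d y ≫ innerCoeff ht k m n x y c = 0 :=
  (Quiv.tensInc_desc _ d).trans (if_neg h)

theorem innerCoeff_tmul_of_ne {c d : S} (h : d ≠ c) (z : quiv ht k m x d)
    (z' : quiv ht k n d y) : (innerCoeff ht k m n x y c).hom (Quiv.tmul z z') = 0 :=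
  LinearMap.congr_fun (congrArg ModuleCat.Hom.hom (tensInc_innerCoeff_of_ne h))
    (TensorProduct.tmul k z z')

variable [Fintype S]

open Classical in
-- Only the summand at `c` is seen by the form, and there it multiplies two endpoint tests. The
-- order conditions hold by assumption, so the result depends on `c` only through its height.
theorem innerCoeff_comult_elt {c : S} (hc : x ≤ c) (hc' : c ≤ y) (s : ℕ →o ℕ) :
    (innerCoeff ht k m n x y c).hom (((comult m n).app x y).hom
      (elt ht k (FinInt.sum m n) x y s)) =
      if s 0 = ht x ∧ s m.len = ht c ∧ s (m.len + n.len) = ht y then (1 : k) else (0 : k) := by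
  rw [comult_elt, map_sum, Finset.sum_eq_single c]
  · refine (innerCoeff_tmul_self c _ _).trans ?_
    rw [augmentation_elt, augmentation_elt]
    change indicator ht k m x c s * indicator ht k n c y (shift m s) = _
    simp only [indicator, shift_apply, Nat.add_zero, hc, hc', true_and, ← ite_and, mul_ite, mul_one, mul_zero]
    congr 1
    apply propext
    tauto
  · exact fun d _ hd => innerCoeff_tmul_of_ne hd _ _
  · exact fun h => (h (Finset.mem_univ c)).elim

/-- The inner vertices of a given height contribute equally to the comultiplication. -/
theorem comult_innerCoeff_eq {c d : S} (hc : x ≤ c) (hc' : c ≤ y) (hd : x ≤ d) (hd' : d ≤ y)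
    (h : ht c = ht d) :
    (comult m n).app x y ≫ innerCoeff ht k m n x y c =
      (comult m n).app x y ≫ innerCoeff ht k m n x y d :=
  hom_ext fun s => by
    rw [ModuleCat.hom_comp, ModuleCat.hom_comp, LinearMap.comp_apply, LinearMap.comp_apply,
      innerCoeff_comult_elt hc hc', innerCoeff_comult_elt hd hd', h]

/-- A comultiplication concentrated at one vertex `z` has coefficient zero at every other vertex. As
`c ≠ d`, the vertex `z` differs from one of them, and the coefficients at `c` and `d` are equal. -/
theorem split_le_ker (hh : StrictMono ht) {c d : S} (hc : x ≤ c) (hc' : c ≤ y) (hd : x ≤ d)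
    (hd' : d ≤ y) (h : ht c = ht d) (hcd : c ≠ d) :
    (tempMod k hh).split x y ≤ LinearMap.ker
      ((comult ⟨1⟩ ⟨1⟩).app x y ≫ innerCoeff ht k ⟨1⟩ ⟨1⟩ x y c).hom := by
  refine iSup_le fun z v => ?_
  rintro ⟨t, htv⟩
  have key : ∀ e : S, z ≠ e →
      ((comult ⟨1⟩ ⟨1⟩).app x y ≫ innerCoeff ht k ⟨1⟩ ⟨1⟩ x y e).hom v = 0 := fun e he =>
    (congrArg (innerCoeff ht k ⟨1⟩ ⟨1⟩ x y e).hom htv.symm).trans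
      (LinearMap.congr_fun (congrArg ModuleCat.Hom.hom (tensInc_innerCoeff_of_ne (S := S) he)) t)
  -- If the simplex is concentrated at `c` itself, its coefficient there is computed at `d` instead.
  by_cases hz : z = c
  · rw [comult_innerCoeff_eq hc hc' hd hd' h]
    exact key d (hz.trans_ne hcd)
  · exact key c hz

/-- A simplex passing through the common height of `c` and `d` has coefficient `1` at `c`, whereas
every element of the split submodule has coefficient `0` there. -/
theorem elt_notMem_split [Nontrivial k] (hh : StrictMono ht) {c d : S} (hc : x ≤ c) (hc' : c ≤ y)
    (hd : x ≤ d) (hd' : d ≤ y) (h : ht c = ht d) (hcd : c ≠ d) {s : ℕ →o ℕ} (h0 : s 0 = ht x)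
    (h1 : s 1 = ht c) (h2 : s 2 = ht y) :
    elt (S := S) ht k ⟨2⟩ x y s ∉ (tempMod k hh).split x y := fun hs =>
  one_ne_zero (α := k) (((innerCoeff_comult_elt (m := ⟨1⟩) (n := ⟨1⟩) hc hc' s).trans
    (if_pos ⟨h0, h1, h2⟩)).symm.trans (split_le_ker hh hc hc' hd hd' h hcd hs))

end Ranked

/-! ### The square -/

/-- The poset `{0 < 1}²`. -/
abbrev Square : Type u := ULift.{u} (Bool × Bool)

namespace Square

/-- The height function on the square. -/
def ht (v : Square.{u}) : ℕ := v.down.1.toNat + v.down.2.toNat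

theorem strictMono_ht : StrictMono ht.{u} := by
  have h : ∀ v w : Bool × Bool, v ≤ w → ¬ w ≤ v →
      v.1.toNat + v.2.toNat < w.1.toNat + w.2.toNat := by decide
  exact fun v w hvw => h v.down w.down (le_of_lt hvw) (not_le_of_gt hvw)

end Square

end Templicial
end

theorem mainTheorem6 (k : Type u) [CommRing k] [Nontrivial k] :
    ¬ (Templicial.PreCat.comparison k).EssSurj ∧
    ∃ (Y : Templicial.TempMod k) (a c₁ c₂ b : Y.vert)
      (f₁ : Y.quiv ⟨1⟩ a c₁) (f₂ : Y.quiv ⟨1⟩ a c₂)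
      (g₁ : Y.quiv ⟨1⟩ c₁ b) (g₂ : Y.quiv ⟨1⟩ c₂ b)
      (h : Y.quiv ⟨1⟩ a b) (w : Y.quiv ⟨2⟩ a b),
      [a, c₁, c₂, b].Nodup ∧ (∀ x : Y.vert, x ∈ [a, c₁, c₂, b]) ∧
      Y.IsFreeGenerator f₁ ∧ Y.IsFreeGenerator f₂ ∧ Y.IsFreeGenerator g₁ ∧
      Y.IsFreeGenerator g₂ ∧ Y.IsFreeGenerator h ∧
      (∀ x y : Y.vert, x ≠ y →
        (x, y) ∉ [(a, c₁), (a, c₂), (c₁, b), (c₂, b), (a, b)] →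
        Subsingleton (Y.quiv ⟨1⟩ x y)) ∧
      (Y.d₁ a b).hom w = h ∧
      (Y.μ₁₁ a b).hom w = Templicial.Quiv.tmul f₁ g₁ + Templicial.Quiv.tmul f₂ g₂ ∧
      (¬ ∃ v : Y.vert → Y.quiv ⟨2⟩ a b,
        w = v a + v c₁ + v c₂ + v b ∧
        ∀ x : Y.vert, (Y.μ₁₁ a b).hom (v x) ∈ LinearMap.range
          (Templicial.Quiv.tensInc (Y.quiv ⟨1⟩) (Y.quiv ⟨1⟩) a x b).hom) ∧
      ¬ (Templicial.PreCat.comparison k).essImage Y := by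
  open Templicial Square Ranked in
  let a : Square.{u} := ⟨false, false⟩
  let c₁ : Square.{u} := ⟨true, false⟩
  let c₂ : Square.{u} := ⟨false, true⟩
  let b : Square.{u} := ⟨true, true⟩
  have hac₁ : a ≤ c₁ := by simp [a, c₁, ← ULift.down_le]
  have hac₂ : a ≤ c₂ := by simp [a, c₂, ← ULift.down_le]
  have hc₁b : c₁ ≤ b := by simp [b, c₁, ← ULift.down_le]
  have hc₂b : c₂ ≤ b := by simp [b, c₂, ← ULift.down_le]
  have hc : c₁ ≠ c₂ := by simp [c₁, c₂]
  -- The simplex `w` is the height sequence `0, 1, 2`; its middle value is the height of both `c₁`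
  -- and `c₂`.
  have hw : elt Square.ht k ⟨2⟩ a b OrderHom.id ∉ (tempMod k strictMono_ht).split a b :=
    elt_notMem_split strictMono_ht hac₁ hc₁b hac₂ hc₂b rfl hc rfl rfl rfl
  have hY : ¬ (PreCat.comparison k).essImage (tempMod k strictMono_ht.{u}) := fun h =>
    hw (TempMod.mem_split_of_essImage h _)
  refine ⟨fun h => hY (h.mem_essImage _), tempMod k strictMono_ht, a, c₁, c₂, b,
    elt ht k ⟨1⟩ a c₁ OrderHom.id, elt ht k ⟨1⟩ a c₂ OrderHom.id,
    -- The edges into `b` start at height 1, hence the shift. These edges and `h` are written in the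
    -- form produced by `comult_elt` and `act_elt`, so that both formulas for `w` can be read off
    -- directly.
    elt ht k ⟨1⟩ c₁ b (shift ⟨1⟩ OrderHom.id), elt ht k ⟨1⟩ c₂ b (shift ⟨1⟩ OrderHom.id),
    elt ht k ⟨1⟩ a b (OrderHom.id.comp (FinInt.Hom.natHom FinInt.innerFace)),
    elt ht k ⟨2⟩ a b OrderHom.id, ?_, ?_, bijective_smul_elt_one ⟨hac₁, rfl, rfl⟩,
    bijective_smul_elt_one ⟨hac₂, rfl, rfl⟩, bijective_smul_elt_one ⟨hc₁b, rfl, rfl⟩,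
    bijective_smul_elt_one ⟨hc₂b, rfl, rfl⟩,
    bijective_smul_elt_one ⟨hac₁.trans hc₁b, rfl, rfl⟩, ?_, act_elt (S := Square) _ _, ?_, ?_, hY⟩
  · change [a, c₁, c₂, b].Nodup
    simp [a, c₁, c₂, b]
  · change ∀ x : Square, x ∈ [a, c₁, c₂, b]
    rintro ⟨⟨_ | _, _ | _⟩⟩ <;> simp [a, c₁, c₂, b]
  · intro x y hxy h
    refine subsingleton_quiv (S := Square) ?_
    change Square at x y
    change (x : Square) ≠ y at hxy
    change (x, y) ∉ [(a, c₁), (a, c₂), (c₁, b), (c₂, b), (a, b)] at h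
    revert hxy h
    -- The five listed pairs are exactly the strict relations of the square, so every remaining pair
    -- of distinct vertices is not in increasing order.
    rcases x with ⟨⟨_ | _, _ | _⟩⟩ <;> rcases y with ⟨⟨_ | _, _ | _⟩⟩ <;>
      simp [a, c₁, c₂, b, ← ULift.down_le]
  · refine (comult_elt (S := Square) (m := ⟨1⟩) (n := ⟨1⟩) OrderHom.id).trans ?_
    rw [← Finset.sum_subset (Finset.subset_univ {c₁, c₂}), Finset.sum_pair hc]
    · rfl
    · intro d _ hd
      -- The other two vertices `a` and `b` have heights 0 and 2, while `w` is cut at height 1.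
      rw [elt_eq_zero, Quiv.zero_tmul]
      revert hd
      rcases d with ⟨⟨_ | _, _ | _⟩⟩ <;> simp [a, c₁, c₂, ht]
  · rintro ⟨v, hv, hx⟩
    refine hw ?_
    -- Each piece lies in the split submodule, hence so would their sum `w`.
    have h : ∀ x, v x ∈ (tempMod k strictMono_ht).split a b := fun x =>
      TempMod.mem_split x (hx x)
    rw [hv]
    exact add_mem (add_mem (add_mem (h a) (h c₁)) (h c₂)) (h b)
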